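/- **Conventions.** $X$ is a smooth $n$-dimensional manifold without boundary (Hausdorff, $\sigma$-compact), $T[1]X$ its shifted tangent bundle, whose functions are the differential forms on $X$ (ghost degree $=$ form degree), and $\mathrm d_X$ the de Rham differential, regarded as a vector field of degree $1$ on $T[1]X$. On graded manifolds, differential forms commute according to total degree (form degree plus ghost degree); for a vector field $V$ of ghost degree $|V|$, $i_V$ is the derivation of degree $|V|-1$ with $i_Vf=0$, $i_V df=Vf$, and $L_V=i_Vd+(-1)^{|V|}d\,i_V$. A vector field $V$ on the total space of a bundle $p:E\to M$ is projectable with projection $v=p_*V$ if $V\circ p^*=p^*\circ v$. A distribution is a finitely generated $C^\infty$-submodule of vector fields. A *weak gauge PDE* $(B,\gamma,\mathcal K_B,T[1]X)$ is a $\mathbb Z$-graded bundle $B\to T[1]X$ with a vector field $\gamma$ of degree $1$ that projects to $\mathrm d_X$ and a vertical involutive distribution $\mathcal K_B$ with $[\gamma,\mathcal K_B]\subseteq\mathcal K_B$ and $\gamma^2\in\mathcal K_B$. A *presymplectic gauge PDE over background* $(E,Q,\omega,\mathcal L)\to(B,\gamma,\mathcal K_B,T[1]X)$ is a $\mathbb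 Z$-graded bundle $\pi_B:E\to B$ over such a $B$, with a vector field $Q$ of degree $1$ on $E$ that projects to $\gamma$, a $2$-form $\omega$ of ghost degree $n-1$ and a function $\mathcal L$ of ghost degree $n$ such that $$d\omega=0,\qquad i_Q\omega+d\mathcal L\in\mathcal I_B,\qquad \tfrac12 i_Qi_Q\omega+Q\mathcal L=0,$$ where $\mathcal I_B$ is the ideal of forms on $E$ generated by the forms $\pi_B^*\alpha$ with $\alpha$ a $1$-form on $B$ such that $i_k\alpha=0$ for all $k\in\mathcal K_B$; moreover every element of $\mathcal K_B$ is the projection of a projectable vector field $V$ on $E$ with $i_V\omega\in\mathcal I_B$. Let $\mathcal K$ be the $C^\infty(E)$-module generated by all $\pi_B$-projectable vector fields $V$ on $E$ with $i_V\omega\in\mathcal I_B$ and $(\pi_B)_*V\in\mathcal K_B$. Let $\chi$ be a $1$-form of ghost degree $n-1$ on $E$ with $d\chi=\omega$. For a section $\sigma:T[1]X\to E$ (a degree-preserving right inverse of the composite projection $E\to B\to T[1]X$) let $$S[\sigma]=\int_{T[1]X}\ell(\sigma),\qquad \ell(\sigma)=\sigma^*(\chi)(\mathrm d_X)+\sigma^*\mathcal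 L$$ be the AKSZ-like action, where $\sigma^*(\alpha)(\mathrm d_X)=i_{\mathrm d_X}\sigma^*\alpha$. Let $E_\sigma=\mathrm d_X\circ\sigma^*-\sigma^*\circ Q$ and put $i_{E_\sigma}\alpha=\sigma^*(\alpha)(\mathrm d_X)-\sigma^*(i_Q\alpha)$ for $1$-forms $\alpha$ on $E$, and $$\tfrac12 i^2_{E_\sigma}\Omega=\sigma^*(\Omega)(\mathrm d_X,\mathrm d_X)-2\,\sigma^*(i_Q\Omega)(\mathrm d_X)+\sigma^*(i_Qi_Q\Omega)$$ for $2$-forms $\Omega$ on $E$, where $\sigma^*(\Omega)(\mathrm d_X,\mathrm d_X)=i_{\mathrm d_X}i_{\mathrm d_X}\sigma^*\Omega$. The section $\sigma$ *projects to a solution of the background gauge PDE* if, with $\sigma_B=\pi_B\circ\sigma$, one has $\mathrm d_X\circ\sigma_B^*=\sigma_B^*\circ\gamma+\sigma_B^*\circ k$ for some $k\in\mathcal K_B$ of degree $1$. **Theorem.** Let $Y$ be a vector field of ghost degree $-1$ on $E$ that is projectable to a vector field $y$ on $T[1]X$, and let $\delta\ell(\sigma)$ denote the first variation of the integrand $\ell(\sigma)$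 under $$\delta\sigma^*=\sigma^*\circ[Q,Y]-[\mathrm d_X,y]\circ\sigma^* .$$ 1. For every section $\sigma$, $$\delta\ell(\sigma)=\sigma^*\big(L_Y(\tfrac12 i_Qi_Q\omega+Q\mathcal L)\big)+i_{E_\sigma}L_Y(i_Q\omega+d\mathcal L)+\tfrac14\,i^2_{E_\sigma}L_Y\omega+\mathrm d_X j_\sigma ,$$ that is, up to a total derivative $\delta S$ is the integral of the first three terms; here $j_\sigma$ is the local current $$j_\sigma=\sigma^*\big(i_{[Q,Y]}\chi+Y\mathcal L\big)+\sigma^*(L_Y\chi)(\mathrm d_X)-y\,\ell(\sigma).$$ 2. Suppose moreover that $Y$ is $\pi_B$-projectable, that $[Y,\mathcal K]\subseteq\mathcal K$, and that $L_Y\omega\in\mathcal I_B$. Then for every section $\sigma$ that projects to a solution of the background gauge PDE, $$\delta\ell(\sigma)=\mathrm d_X j_\sigma ,$$ that is, the transformation leaves the action $S$ invariant up to total derivatives. -/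

import Mathlib

open scoped Manifold ContDiff

universe u v w

namespace GradedGeometry

noncomputable section

/-- The sign `(-1)^n`. -/
def sgn (n : ℤ) : ℝ := (-1 : ℝ) ^ n

theorem sgn_add (m n : ℤ) : sgn (m + n) = sgn m * sgn n :=
  zpow_add₀ (by norm_num) m n

@[simp] theorem sgn_zero : sgn 0 = 1 := by simp [sgn]

@[simp] theorem sgn_one : sgn 1 = -1 := by simp [sgn]

@[simp] theorem sgn_neg (n : ℤ) : sgn (-n) = sgn n := by
  unfold sgn
  rw [zpow_neg, ← inv_zpow]
  norm_num

theorem sgn_mul_self (n : ℤ) : sgn n * sgn n = 1 := by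
  rw [← sgn_add]
  exact Even.neg_one_zpow (Even.add_self n)

/-- The ideal of elements killed by a character. -/
def maxIdeal {R : Type*} [Ring R] [Algebra ℝ R] (p : R →ₐ[ℝ] ℝ) : Submodule ℝ R := LinearMap.ker p.toLinearMap

theorem mem_maxIdeal {R : Type*} [Ring R] [Algebra ℝ R] {p : R →ₐ[ℝ] ℝ} {x : R} : x ∈ maxIdeal p ↔ p x = 0 := Iff.rfl

/-- Graded geometry is expressed through algebras of functions.  A `GradedSpace` is a `ℤ`-graded
(by ghost degree) graded-commutative real algebra `Fn` together with a body `points`: a set of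
degree preserving characters `Fn → ℝ` such that a function whose formal Taylor expansion vanishes at
every point (it lies in all the powers of the ideal of functions vanishing there) is zero.
Every `ℤ`-graded manifold is a `GradedSpace` through its algebra of functions and the evaluations
at the points of its body. -/
structure GradedSpace where
  Fn : Type u
  [ring : Ring Fn]
  [algebra : Algebra ℝ Fn]
  deg : ℤ → Submodule ℝ Fn
  [graded : GradedAlgebra deg]
  gradedComm : ∀ {i j : ℤ} {a b : Fn}, a ∈ deg i → b ∈ deg j → a * b = sgn (i * j) • (b * a)
  points : Set (Fn →ₐ[ℝ] ℝ)
  point_deg : ∀ p ∈ points, ∀ {i : ℤ} {a : Fn}, i ≠ 0 → a ∈ deg i → p a = 0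
  separated : ∀ a : Fn,
    (∀ p ∈ points, ∀ k : ℕ, a ∈ maxIdeal p ^ (k + 1)) → a = 0

attribute [instance] GradedSpace.ring GradedSpace.algebra GradedSpace.graded

/-- A map of graded spaces, given by the degree preserving pullback of functions; it sends points
to points. -/
structure Hom (M : GradedSpace.{u}) (N : GradedSpace.{v}) where
  pull : N.Fn →ₐ[ℝ] M.Fn
  map_deg : ∀ {i : ℤ} {a : N.Fn}, a ∈ N.deg i → pull a ∈ M.deg i
  map_points : ∀ p ∈ M.points, p.comp pull ∈ N.points

/-- The identity map. -/
def Hom.id (M : GradedSpace.{u}) : Hom M M where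
  pull := AlgHom.id ℝ M.Fn
  map_deg h := h
  map_points _ h := h

/-- Composition of maps: first `φ : M → N`, then `ψ : N → P`. -/
def Hom.comp {M : GradedSpace.{u}} {N : GradedSpace.{v}} {P : GradedSpace.{w}}
    (ψ : Hom N P) (φ : Hom M N) : Hom M P where
  pull := φ.pull.comp ψ.pull
  map_deg h := φ.map_deg (ψ.map_deg h)
  map_points p hp := ψ.map_points _ (φ.map_points p hp)

/-- A vector field of ghost degree `k` along a map `φ : M → N`. -/
structure VectorAlong {M : GradedSpace.{u}} {N : GradedSpace.{v}} (φ : Hom M N) (k : ℤ) where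
  toFun : N.Fn →ₗ[ℝ] M.Fn
  map_deg : ∀ {i : ℤ} {a : N.Fn}, a ∈ N.deg i → toFun a ∈ M.deg (i + k)
  leibniz : ∀ {i : ℤ} {a : N.Fn}, a ∈ N.deg i → ∀ b : N.Fn,
    toFun (a * b) = toFun a * φ.pull b + sgn (k * i) • (φ.pull a * toFun b)

/-- A vector field of ghost degree `k`, i.e. a graded derivation of the algebra of functions. -/
abbrev VectorField (M : GradedSpace.{u}) (k : ℤ) := VectorAlong (Hom.id M) k

theorem VectorAlong.leibniz_field {M : GradedSpace.{u}} {k : ℤ} (V : VectorField M k) {i : ℤ}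
    {a : M.Fn} (h : a ∈ M.deg i) (b : M.Fn) :
    V.toFun (a * b) = V.toFun a * b + sgn (k * i) • (a * V.toFun b) :=
  V.leibniz h b

/-- The graded commutator `[V, W] = V W - (-1)^{|V||W|} W V`. -/
def bracket {M : GradedSpace.{u}} {k l : ℤ} (V : VectorField M k) (W : VectorField M l) :
    VectorField M (k + l) where
  toFun := V.toFun ∘ₗ W.toFun - sgn (k * l) • (W.toFun ∘ₗ V.toFun)
  map_deg {i a} h := by
    refine Submodule.sub_mem _ ?_ (Submodule.smul_mem _ _ ?_)
    · have := V.map_deg (W.map_deg h)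
      rwa [show i + l + k = i + (k + l) by ring] at this
    · have := W.map_deg (V.map_deg h)
      rwa [show i + k + l = i + (k + l) by ring] at this
  leibniz {i a} h b := by
    change V.toFun (W.toFun (a * b)) - sgn (k * l) • W.toFun (V.toFun (a * b)) =
      (V.toFun (W.toFun a) - sgn (k * l) • W.toFun (V.toFun a)) * b +
        sgn ((k + l) * i) • (a * (V.toFun (W.toFun b) - sgn (k * l) • W.toFun (V.toFun b)))
    have e1 : sgn (k * (i + l)) = sgn (k * i) * sgn (k * l) := by rw [← sgn_add]; congr 1; ring
    have e2 : sgn (l * (i + k)) = sgn (l * i) * sgn (k * l) := by rw [← sgn_add]; congr 1; ring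
    have e3 : sgn ((k + l) * i) = sgn (k * i) * sgn (l * i) := by rw [← sgn_add]; congr 1; ring
    have e4 := sgn_mul_self (k * l)
    rw [W.leibniz_field h, V.leibniz_field h, map_add, map_add, map_smul, map_smul,
      V.leibniz_field (W.map_deg h), W.leibniz_field (V.map_deg h), V.leibniz_field h,
      W.leibniz_field h, e1, e2, e3]
    simp only [mul_sub, sub_mul, smul_add, smul_sub, smul_smul, mul_smul_comm, smul_mul_assoc]
    have e5 : sgn (k * l) * (sgn (l * i) * sgn (k * l)) = sgn (l * i) := by
      linear_combination sgn (l * i) * e4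
    have e7 : sgn (k * l) * (sgn (k * i) * sgn (l * i)) =
      sgn (k * i) * sgn (l * i) * sgn (k * l) := by ring
    have e8 : sgn (k * l) * sgn (k * i) = sgn (k * i) * sgn (k * l) := mul_comm _ _
    have e9 : sgn (l * i) * sgn (k * i) = sgn (k * i) * sgn (l * i) := mul_comm _ _
    rw [e5, e8, e9, e7]
    abel

namespace GradedSpace

/-! ### Powers of the ideal of functions vanishing at a point -/

section Ker

variable {R : Type*} [Ring R] [Algebra ℝ R]

theorem maxIdeal_mul_right (p : R →ₐ[ℝ] ℝ) (k : ℕ) {x : R}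
    (hx : x ∈ maxIdeal p ^ (k + 1)) (y : R) : x * y ∈ maxIdeal p ^ (k + 1) := by
  rw [Submodule.pow_succ] at hx ⊢
  induction hx using Submodule.mul_induction_on' with
  | mem_mul_mem a ha b hb =>
    rw [mul_assoc]
    refine Submodule.mul_mem_mul ha ?_
    rw [mem_maxIdeal] at hb ⊢
    rw [map_mul, hb, zero_mul]
  | add a _ b _ ha hb => rw [add_mul]; exact Submodule.add_mem _ ha hb

theorem maxIdeal_mul_left (p : R →ₐ[ℝ] ℝ) (k : ℕ) {x : R}
    (hx : x ∈ maxIdeal p ^ (k + 1)) (y : R) : y * x ∈ maxIdeal p ^ (k + 1) := by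
  induction k generalizing x with
  | zero =>
    rw [zero_add, Submodule.pow_one, mem_maxIdeal] at hx ⊢
    rw [map_mul, hx, mul_zero]
  | succ k ih =>
    rw [Submodule.pow_succ] at hx ⊢
    induction hx using Submodule.mul_induction_on' with
    | mem_mul_mem a ha b hb => rw [← mul_assoc]; exact Submodule.mul_mem_mul (ih ha) hb
    | add a _ b _ ha hb => rw [mul_add]; exact Submodule.add_mem _ ha hb

/-- A linear map compatible with a multiplicative filtration respects powers. -/
theorem maxIdeal_pow_map {T : Type*} [Ring T] [Algebra ℝ T] (p : R →ₐ[ℝ] ℝ) (Ψ : R →ₐ[ℝ] T)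
    (N : ℕ → Submodule ℝ T) (h0 : ∀ x ∈ maxIdeal p, Ψ x ∈ N 0)
    (hs : ∀ k, ∀ x ∈ N k, ∀ y ∈ N 0, x * y ∈ N (k + 1)) (k : ℕ) {x : R}
    (hx : x ∈ maxIdeal p ^ (k + 1)) : Ψ x ∈ N k := by
  induction k generalizing x with
  | zero => rw [zero_add, Submodule.pow_one] at hx; exact h0 x hx
  | succ k ih =>
    rw [Submodule.pow_succ] at hx
    induction hx using Submodule.mul_induction_on' with
    | mem_mul_mem a ha b hb => rw [map_mul]; exact hs k _ (ih ha) _ (h0 b hb)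
    | add a _ b _ ha hb => rw [map_add]; exact Submodule.add_mem _ ha hb

end Ker

/-! ### Parity and extension by linearity -/

variable (M : GradedSpace.{u})

theorem hom_induction {C : M.Fn → Prop} (h0 : C 0) (hadd : ∀ a b, C a → C b → C (a + b))
    (hom : ∀ (i : ℤ) (a : M.Fn), a ∈ M.deg i → C a) (a : M.Fn) : C a :=
  DirectSum.Decomposition.inductionOn M.deg h0 (fun {i} m => hom i m m.2) hadd a

/-- The linear map acting on elements of degree `i` by `F i`. -/
def gradedLin {T : Type*} [AddCommGroup T] [Module ℝ T] (F : ℤ → M.Fn →ₗ[ℝ] T) :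
    M.Fn →ₗ[ℝ] T :=
  (DirectSum.toModule ℝ ℤ T (fun i => F i ∘ₗ (M.deg i).subtype)) ∘ₗ
    (DirectSum.decomposeLinearEquiv M.deg).toLinearMap

theorem gradedLin_apply {T : Type*} [AddCommGroup T] [Module ℝ T] (F : ℤ → M.Fn →ₗ[ℝ] T) {i : ℤ}
    {a : M.Fn} (h : a ∈ M.deg i) : M.gradedLin F a = F i a := by
  simp only [gradedLin, LinearMap.comp_apply, LinearEquiv.coe_coe,
    DirectSum.decomposeLinearEquiv_apply]
  rw [DirectSum.decompose_of_mem M.deg h]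
  exact DirectSum.toModule_lof ℝ i _

/-- The algebra map acting on elements of degree `i` by `F i`. -/
def gradedAlg {T : Type*} [Ring T] [Algebra ℝ T] (F : ℤ → M.Fn →ₗ[ℝ] T) (h1 : F 0 1 = 1)
    (hmul : ∀ i j a b, a ∈ M.deg i → b ∈ M.deg j → F (i + j) (a * b) = F i a * F j b) :
    M.Fn →ₐ[ℝ] T :=
  AlgHom.ofLinearMap (M.gradedLin F)
    (by rw [M.gradedLin_apply F SetLike.GradedOne.one_mem, h1])
    (by
      intro x y
      induction x using M.hom_induction with
      | h0 => simp
      | hadd a b ha hb => rw [add_mul, map_add, ha, hb, map_add, add_mul]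
      | hom i a ha =>
        induction y using M.hom_induction with
        | h0 => simp
        | hadd c d hc hd => rw [mul_add, map_add, hc, hd, map_add, mul_add]
        | hom j b hb =>
          rw [M.gradedLin_apply F (SetLike.GradedMul.mul_mem ha hb), M.gradedLin_apply F ha,
            M.gradedLin_apply F hb, hmul i j a b ha hb])

theorem gradedAlg_apply {T : Type*} [Ring T] [Algebra ℝ T] (F : ℤ → M.Fn →ₗ[ℝ] T) (h1 hmul)
    {i : ℤ} {a : M.Fn} (h : a ∈ M.deg i) : M.gradedAlg F h1 hmul a = F i a :=
  M.gradedLin_apply F h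

/-- The automorphism acting by `(-1)^{k i}` on functions of degree `i`. -/
def parity (k : ℤ) : M.Fn →ₐ[ℝ] M.Fn :=
  M.gradedAlg (fun i => sgn (k * i) • LinearMap.id) (by simp)
    (by
      intro i j a b _ _
      simp only [LinearMap.smul_apply, LinearMap.id_apply, mul_add, sgn_add, smul_mul_smul_comm])

theorem parity_apply (k : ℤ) {i : ℤ} {a : M.Fn} (h : a ∈ M.deg i) :
    M.parity k a = sgn (k * i) • a :=
  M.gradedAlg_apply _ _ _ h

theorem point_parity (k : ℤ) {p : M.Fn →ₐ[ℝ] ℝ} (hp : p ∈ M.points) (a : M.Fn) :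
    p (M.parity k a) = p a := by
  induction a using M.hom_induction with
  | h0 => simp
  | hadd a b ha hb => rw [map_add, map_add, map_add, ha, hb]
  | hom i a ha =>
    rw [M.parity_apply k ha, map_smul]
    by_cases hi : i = 0
    · simp [hi]
    · simp [M.point_deg p hp hi ha]

/-! ### The algebra of forms -/

/-- Relations between the generators `f = ι (f, 0)` and `d f = ι (0, f)`. -/
inductive KRel : TensorAlgebra ℝ (M.Fn × M.Fn) → TensorAlgebra ℝ (M.Fn × M.Fn) → Prop
  | one : KRel (TensorAlgebra.ι ℝ (1, 0)) 1
  | mul (a b : M.Fn) : KRel (TensorAlgebra.ι ℝ (a * b, 0))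
      (TensorAlgebra.ι ℝ (a, 0) * TensorAlgebra.ι ℝ (b, 0))
  | leibniz {i : ℤ} {a : M.Fn} (b : M.Fn) (ha : a ∈ M.deg i) : KRel (TensorAlgebra.ι ℝ (0, a * b))
      (TensorAlgebra.ι ℝ (0, a) * TensorAlgebra.ι ℝ (b, 0) +
        sgn i • (TensorAlgebra.ι ℝ (a, 0) * TensorAlgebra.ι ℝ (0, b)))
  | comm_fd {i j : ℤ} {a b : M.Fn} (ha : a ∈ M.deg i) (hb : b ∈ M.deg j) :
      KRel (TensorAlgebra.ι ℝ (a, 0) * TensorAlgebra.ι ℝ (0, b))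
        (sgn (i * (j + 1)) • (TensorAlgebra.ι ℝ (0, b) * TensorAlgebra.ι ℝ (a, 0)))
  | comm_dd {i j : ℤ} {a b : M.Fn} (ha : a ∈ M.deg i) (hb : b ∈ M.deg j) :
      KRel (TensorAlgebra.ι ℝ (0, a) * TensorAlgebra.ι ℝ (0, b))
        (sgn ((i + 1) * (j + 1)) • (TensorAlgebra.ι ℝ (0, b) * TensorAlgebra.ι ℝ (0, a)))

/-- The graded-commutative algebra of Kähler forms: generated by functions `f` and their
differentials `d f`. -/
abbrev Kahler : Type u := RingQuot M.KRel

namespace Kahler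

def gen : M.Fn × M.Fn →ₗ[ℝ] M.Kahler :=
  (RingQuot.mkAlgHom ℝ M.KRel).toLinearMap ∘ₗ TensorAlgebra.ι ℝ

def fn : M.Fn →ₐ[ℝ] M.Kahler :=
  AlgHom.ofLinearMap (gen M ∘ₗ LinearMap.inl ℝ M.Fn M.Fn)
    (by
      have := RingQuot.mkAlgHom_rel ℝ (KRel.one (M := M))
      rw [map_one] at this
      exact this)
    (by
      intro a b
      have := RingQuot.mkAlgHom_rel ℝ (KRel.mul (M := M) a b)
      rw [map_mul] at this
      exact this)

def dd : M.Fn →ₗ[ℝ] M.Kahler := gen M ∘ₗ LinearMap.inr ℝ M.Fn M.Fn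

variable {M}

theorem dd_mul {i : ℤ} {a : M.Fn} (b : M.Fn) (ha : a ∈ M.deg i) :
    dd M (a * b) = dd M a * fn M b + sgn i • (fn M a * dd M b) := by
  have := RingQuot.mkAlgHom_rel ℝ (KRel.leibniz b ha)
  rw [map_add, map_smul, map_mul, map_mul] at this
  exact this

theorem fn_dd {i j : ℤ} {a b : M.Fn} (ha : a ∈ M.deg i) (hb : b ∈ M.deg j) :
    fn M a * dd M b = sgn (i * (j + 1)) • (dd M b * fn M a) := by
  have := RingQuot.mkAlgHom_rel ℝ (KRel.comm_fd ha hb)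
  rw [map_smul, map_mul, map_mul] at this
  exact this

theorem dd_dd {i j : ℤ} {a b : M.Fn} (ha : a ∈ M.deg i) (hb : b ∈ M.deg j) :
    dd M a * dd M b = sgn ((i + 1) * (j + 1)) • (dd M b * dd M a) := by
  have := RingQuot.mkAlgHom_rel ℝ (KRel.comm_dd ha hb)
  rw [map_smul, map_mul, map_mul] at this
  exact this

theorem induction {C : M.Kahler → Prop} (hfn : ∀ a, C (fn M a)) (hdd : ∀ a, C (dd M a))
    (hmul : ∀ x y, C x → C y → C (x * y)) (hadd : ∀ x y, C x → C y → C (x + y)) (x : M.Kahler) :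
    C x := by
  obtain ⟨t, rfl⟩ := RingQuot.mkAlgHom_surjective ℝ M.KRel x
  induction t using TensorAlgebra.induction with
  | algebraMap r =>
    have := hfn (algebraMap ℝ M.Fn r)
    rwa [AlgHom.commutes] at this ⊢
  | ι m =>
    have := hadd _ _ (hfn m.1) (hdd m.2)
    change C (gen M (m.1, 0) + gen M (0, m.2)) at this
    rw [← map_add, Prod.mk_add_mk, add_zero, zero_add] at this
    exact this
  | mul a b ha hb => rw [map_mul]; exact hmul _ _ ha hb
  | add a b ha hb => rw [map_add]; exact hadd _ _ ha hb

variable {T : Type*} [Ring T] [Algebra ℝ T]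

/-- Universal property of the Kähler forms. -/
def lift (f : M.Fn →ₐ[ℝ] T) (δ : M.Fn →ₗ[ℝ] T)
    (hl : ∀ {i : ℤ} {a : M.Fn} (b : M.Fn), a ∈ M.deg i →
      δ (a * b) = δ a * f b + sgn i • (f a * δ b))
    (hfd : ∀ {i j : ℤ} {a b : M.Fn}, a ∈ M.deg i → b ∈ M.deg j →
      f a * δ b = sgn (i * (j + 1)) • (δ b * f a))
    (hdd : ∀ {i j : ℤ} {a b : M.Fn}, a ∈ M.deg i → b ∈ M.deg j →
      δ a * δ b = sgn ((i + 1) * (j + 1)) • (δ b * δ a)) :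
    M.Kahler →ₐ[ℝ] T :=
  RingQuot.liftAlgHom ℝ ⟨TensorAlgebra.lift ℝ (LinearMap.coprod f.toLinearMap δ), by
    intro x y h
    induction h with
    | one => simp
    | mul a b => simp
    | leibniz b ha => simp [hl b ha]
    | comm_fd ha hb => simp [hfd ha hb]
    | comm_dd ha hb => simp [hdd ha hb]⟩

@[simp] theorem lift_fn (f : M.Fn →ₐ[ℝ] T) (δ : M.Fn →ₗ[ℝ] T) (hl hfd hdd) (a : M.Fn) :
    lift f δ hl hfd hdd (fn M a) = f a := by
  change RingQuot.liftAlgHom ℝ _ (RingQuot.mkAlgHom ℝ M.KRel (TensorAlgebra.ι ℝ (a, 0))) = _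
  rw [RingQuot.liftAlgHom_mkAlgHom_apply]
  simp

@[simp] theorem lift_dd (f : M.Fn →ₐ[ℝ] T) (δ : M.Fn →ₗ[ℝ] T) (hl hfd hdd) (a : M.Fn) :
    lift f δ hl hfd hdd (dd M a) = δ a := by
  change RingQuot.liftAlgHom ℝ _ (RingQuot.mkAlgHom ℝ M.KRel (TensorAlgebra.ι ℝ (0, a))) = _
  rw [RingQuot.liftAlgHom_mkAlgHom_apply]
  simp

variable (M)

/-- The restriction of a form to its component of form degree zero. -/
def scalar : M.Kahler →ₐ[ℝ] M.Fn :=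
  lift (AlgHom.id ℝ M.Fn) 0 (by simp) (by simp) (by simp)

/-- Kähler forms that vanish to infinite order at every point of the body. -/
def flat : Ideal M.Kahler where
  carrier := {x | ∀ p ∈ M.points, ∀ k : ℕ, x ∈ maxIdeal (p.comp (scalar M)) ^ (k + 1)}
  zero_mem' _ _ _ := Submodule.zero_mem _
  add_mem' hx hy p hp k := Submodule.add_mem _ (hx p hp k) (hy p hp k)
  smul_mem' c _ hx p hp k := maxIdeal_mul_left _ k (hx p hp k) c

instance : (flat M).IsTwoSided where
  mul_mem_of_left b ha p hp k := maxIdeal_mul_right _ k (ha p hp k) b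

end Kahler

/-- The algebra of differential forms: Kähler forms modulo those vanishing to infinite order at
every point (a relation `∑ f dg = 0` between smooth forms holds in the quotient, for instance
`d (sin x) = cos x d x`). -/
abbrev Form : Type u := M.Kahler ⧸ Kahler.flat M

namespace Form

/-- A function seen as a form of form degree zero. -/
def ofFn : M.Fn →ₐ[ℝ] M.Form := (Ideal.Quotient.mkₐ ℝ (Kahler.flat M)).comp (Kahler.fn M)

/-- The differential of a function. -/
def dFn : M.Fn →ₗ[ℝ] M.Form :=
  (Ideal.Quotient.mkₐ ℝ (Kahler.flat M)).toLinearMap ∘ₗ Kahler.dd M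

/-- The component of form degree zero of a form, as a function. -/
def scalar : M.Form →ₐ[ℝ] M.Fn :=
  Ideal.Quotient.liftₐ (Kahler.flat M) (Kahler.scalar M) (by
    intro x hx
    refine M.separated _ fun p hp k => ?_
    refine maxIdeal_pow_map (p.comp (Kahler.scalar M)) (Kahler.scalar M)
      (fun k => maxIdeal p ^ (k + 1)) ?_ ?_ k (hx p hp k)
    · intro y hy
      rw [zero_add, Submodule.pow_one]
      exact hy
    · intro k x hx y hy
      rw [zero_add, Submodule.pow_one] at hy
      rw [Submodule.pow_succ]
      exact Submodule.mul_mem_mul hx hy)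

variable {M}

@[simp] theorem scalar_ofFn (a : M.Fn) : scalar M (ofFn M a) = a := by
  change Kahler.scalar M (Kahler.fn M a) = a
  simp [Kahler.scalar]

@[simp] theorem scalar_dFn (a : M.Fn) : scalar M (dFn M a) = 0 := by
  change Kahler.scalar M (Kahler.dd M a) = 0
  simp [Kahler.scalar]

theorem dFn_mul {i : ℤ} {a : M.Fn} (b : M.Fn) (ha : a ∈ M.deg i) :
    dFn M (a * b) = dFn M a * ofFn M b + sgn i • (ofFn M a * dFn M b) := by
  have := congrArg (Ideal.Quotient.mkₐ ℝ (Kahler.flat M)) (Kahler.dd_mul b ha)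
  rw [map_add, map_smul, map_mul (Ideal.Quotient.mkₐ ℝ (Kahler.flat M)) (Kahler.dd M a),
    map_mul (Ideal.Quotient.mkₐ ℝ (Kahler.flat M)) (Kahler.fn M a)] at this
  exact this

theorem ofFn_dFn {i j : ℤ} {a b : M.Fn} (ha : a ∈ M.deg i) (hb : b ∈ M.deg j) :
    ofFn M a * dFn M b = sgn (i * (j + 1)) • (dFn M b * ofFn M a) := by
  have := congrArg (Ideal.Quotient.mkₐ ℝ (Kahler.flat M)) (Kahler.fn_dd ha hb)
  rwa [map_smul, map_mul, map_mul] at this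

theorem dFn_dFn {i j : ℤ} {a b : M.Fn} (ha : a ∈ M.deg i) (hb : b ∈ M.deg j) :
    dFn M a * dFn M b = sgn ((i + 1) * (j + 1)) • (dFn M b * dFn M a) := by
  have := congrArg (Ideal.Quotient.mkₐ ℝ (Kahler.flat M)) (Kahler.dd_dd ha hb)
  rwa [map_smul, map_mul, map_mul] at this

theorem ofFn_ofFn {i j : ℤ} {a b : M.Fn} (ha : a ∈ M.deg i) (hb : b ∈ M.deg j) :
    ofFn M a * ofFn M b = sgn (i * j) • (ofFn M b * ofFn M a) := by
  rw [← map_mul, M.gradedComm ha hb, map_smul, map_mul]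

theorem induction {C : M.Form → Prop} (hfn : ∀ a, C (ofFn M a)) (hdd : ∀ a, C (dFn M a))
    (hmul : ∀ x y, C x → C y → C (x * y)) (hadd : ∀ x y, C x → C y → C (x + y)) (x : M.Form) :
    C x := by
  obtain ⟨y, rfl⟩ := Ideal.Quotient.mkₐ_surjective ℝ (Kahler.flat M) x
  induction y using Kahler.induction with
  | hfn a => exact hfn a
  | hdd a => exact hdd a
  | hmul x y hx hy => rw [map_mul]; exact hmul _ _ hx hy
  | hadd x y hx hy => rw [map_add]; exact hadd _ _ hx hy

/-- Products of homogeneous functions and of differentials of homogeneous functions, with their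
total degree (ghost degree plus form degree). -/
inductive Word : ℤ → M.Form → Prop
  | one : Word 0 1
  | fn {i n : ℤ} {a : M.Fn} {x : M.Form} (ha : a ∈ M.deg i) (hx : Word n x) :
      Word (i + n) (ofFn M a * x)
  | dd {i n : ℤ} {a : M.Fn} {x : M.Form} (ha : a ∈ M.deg i) (hx : Word n x) :
      Word (i + 1 + n) (dFn M a * x)

theorem Word.mul {m n : ℤ} {x y : M.Form} (hx : Word m x) (hy : Word n y) :
    Word (m + n) (x * y) := by
  induction hx with
  | one => simpa using hy
  | fn ha _ ih => rw [mul_assoc, add_assoc]; exact Word.fn ha ih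
  | dd ha _ ih => rw [mul_assoc, add_assoc _ _ n]; exact Word.dd ha ih

theorem Word.ofFn {i : ℤ} {a : M.Fn} (ha : a ∈ M.deg i) : Word i (ofFn M a) := by
  simpa using Word.fn ha Word.one

theorem Word.dFn {i : ℤ} {a : M.Fn} (ha : a ∈ M.deg i) : Word (i + 1) (dFn M a) := by
  simpa using Word.dd ha Word.one

/-- Graded commutation of `z` (of degree `i`) with a product, from that with the factors. -/
theorem comm_mul {R : Type*} [Ring R] [Algebra ℝ R] {i m n : ℤ} {z x y : R}
    (hx : z * x = sgn (i * m) • (x * z)) (hy : z * y = sgn (i * n) • (y * z)) :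
    z * (x * y) = sgn (i * (m + n)) • (x * y * z) := by
  rw [← mul_assoc, hx, smul_mul_assoc, mul_assoc, hy, mul_smul_comm, smul_smul, mul_add, sgn_add,
    mul_assoc]

theorem comm_symm {R : Type*} [Ring R] [Algebra ℝ R] {i j : ℤ} {x y : R}
    (h : x * y = sgn (i * j) • (y * x)) : y * x = sgn (j * i) • (x * y) := by
  rw [h, smul_smul, mul_comm j i, sgn_mul_self, one_smul]

theorem Word.comm {m n : ℤ} {x y : M.Form} (hx : Word m x) (hy : Word n y) :
    x * y = sgn (m * n) • (y * x) := by
  have key : ∀ {i : ℤ} {z : M.Form},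
      (∀ {j : ℤ} {b : M.Fn}, b ∈ M.deg j → z * Form.ofFn M b = sgn (i * j) • (Form.ofFn M b * z)) →
      (∀ {j : ℤ} {b : M.Fn}, b ∈ M.deg j →
        z * Form.dFn M b = sgn (i * (j + 1)) • (Form.dFn M b * z)) →
      z * y = sgn (i * n) • (y * z) := by
    intro i z h1 h2
    induction hy with
    | one => simp
    | fn hb _ ih => exact comm_mul (h1 hb) ih
    | dd hb _ ih => exact comm_mul (h2 hb) ih
  induction hx with
  | one => simp
  | fn ha _ ih =>
    refine comm_symm (comm_mul (comm_symm ?_) (comm_symm ih))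
    exact key (fun hb => ofFn_ofFn ha hb) (fun hb => ofFn_dFn ha hb)
  | dd ha _ ih =>
    refine comm_symm (comm_mul (comm_symm ?_) (comm_symm ih))
    exact key (fun hb => comm_symm (ofFn_dFn hb ha)) (fun hb => dFn_dFn ha hb)

variable (M)

/-- Forms of total degree `n`. -/
def deg (n : ℤ) : Submodule ℝ M.Form := Submodule.span ℝ {x | Word n x}

theorem mem_deg_of_word {n : ℤ} {x : M.Form} (h : Word n x) : x ∈ deg M n :=
  Submodule.subset_span h

theorem mul_mem_deg {m n : ℤ} {x y : M.Form} (hx : x ∈ deg M m) (hy : y ∈ deg M n) :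
    x * y ∈ deg M (m + n) := by
  have : deg M m * deg M n ≤ deg M (m + n) := by
    rw [deg, deg, Submodule.span_mul_span, Submodule.span_le]
    rintro _ ⟨a, ha, b, hb, rfl⟩
    exact mem_deg_of_word M (Word.mul ha hb)
  exact this (Submodule.mul_mem_mul hx hy)

instance : SetLike.GradedMonoid (deg M) where
  one_mem := mem_deg_of_word M Word.one
  mul_mem _ _ _ _ hx hy := mul_mem_deg M hx hy

theorem deg_comm {m n : ℤ} {x y : M.Form} (hx : x ∈ deg M m) (hy : y ∈ deg M n) :
    x * y = sgn (m * n) • (y * x) := by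
  induction hx using Submodule.span_induction with
  | mem x hx =>
    induction hy using Submodule.span_induction with
    | mem y hy => exact Word.comm hx hy
    | zero => simp
    | add a b _ _ ha hb => rw [mul_add, ha, hb, add_mul, smul_add]
    | smul r a _ ha => rw [mul_smul_comm, ha, smul_mul_assoc, smul_comm]
  | zero => simp
  | add a b _ _ ha hb => rw [add_mul, ha, hb, mul_add, smul_add]
  | smul r a _ ha => rw [smul_mul_assoc, ha, mul_smul_comm, smul_comm]

theorem maxIdeal_scalar (p : M.Fn →ₐ[ℝ] ℝ) (k : ℕ) :
    maxIdeal (p.comp (scalar M)) ^ k =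
      (maxIdeal (p.comp (Kahler.scalar M)) ^ k).map
        (Ideal.Quotient.mkₐ ℝ (Kahler.flat M)).toLinearMap := by
  have h1 : maxIdeal (p.comp (scalar M)) = (maxIdeal (p.comp (Kahler.scalar M))).map
        (Ideal.Quotient.mkₐ ℝ (Kahler.flat M)).toLinearMap := by
    ext x
    obtain ⟨y, rfl⟩ := Ideal.Quotient.mkₐ_surjective ℝ (Kahler.flat M) x
    constructor
    · intro h
      exact ⟨y, h, rfl⟩
    · rintro ⟨z, hz, hzy⟩
      change Ideal.Quotient.mkₐ ℝ (Kahler.flat M) z = _ at hzy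
      rw [← hzy]
      exact hz
  rw [h1, ← Submodule.map_pow]

theorem eq_zero_of_flat (x : M.Form)
    (h : ∀ p ∈ M.points, ∀ k : ℕ, x ∈ maxIdeal (p.comp (scalar M)) ^ (k + 1)) : x = 0 := by
  obtain ⟨y, rfl⟩ := Ideal.Quotient.mkₐ_surjective ℝ (Kahler.flat M) x
  refine Ideal.Quotient.eq_zero_iff_mem.mpr ?_
  intro p hp k
  have := h p hp k
  rw [maxIdeal_scalar] at this
  obtain ⟨z, hz, hzy⟩ := this
  have h2 : y - z ∈ Kahler.flat M := by
    rw [← Ideal.Quotient.eq]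
    exact hzy.symm
  have := Submodule.add_mem _ (h2 p hp k) hz
  rwa [sub_add_cancel] at this

/-- The monomial `x T^i` in the Laurent polynomials over forms. -/
def mono (i : ℤ) : M.Form →ₗ[ℝ] AddMonoidAlgebra M.Form ℤ := AddMonoidAlgebra.lsingle i

variable {M} in
theorem mono_mul (i j : ℤ) (x y : M.Form) : mono M i x * mono M j y = mono M (i + j) (x * y) :=
  AddMonoidAlgebra.single_mul_single ..

theorem mono_one : mono M 0 1 = 1 := rfl

/-- The algebra map to Laurent polynomials recording the degrees of homogeneous functions. -/
def coactK : M.Kahler →ₐ[ℝ] AddMonoidAlgebra M.Form ℤ :=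
  Kahler.lift
    (M.gradedAlg (fun i => mono M i ∘ₗ (ofFn M).toLinearMap)
      (by
        rw [LinearMap.comp_apply, AlgHom.toLinearMap_apply, map_one, mono_one])
      (by
        intro i j a b _ _
        simp only [LinearMap.comp_apply, AlgHom.toLinearMap_apply, map_mul, mono_mul]))
    (M.gradedLin (fun i => mono M (i + 1) ∘ₗ dFn M))
    (by
      intro i a b ha
      induction b using M.hom_induction with
      | h0 => simp
      | hadd b c hb hc =>
        rw [mul_add, map_add, hb, hc, map_add, map_add]
        simp only [mul_add, smul_add]
        abel
      | hom j b hb =>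
        rw [gradedLin_apply _ _ (SetLike.GradedMul.mul_mem ha hb), gradedLin_apply _ _ ha,
          gradedLin_apply _ _ hb, gradedAlg_apply _ _ _ _ hb, gradedAlg_apply _ _ _ _ ha]
        simp only [LinearMap.comp_apply, AlgHom.toLinearMap_apply, mono_mul, dFn_mul b ha, map_add,
          map_smul]
        rw [show i + j + 1 = i + 1 + j by ring, show i + (j + 1) = i + 1 + j by ring])
    (by
      intro i j a b ha hb
      rw [gradedLin_apply _ _ hb, gradedAlg_apply _ _ _ _ ha]
      simp only [LinearMap.comp_apply, AlgHom.toLinearMap_apply, mono_mul, ofFn_dFn ha hb, map_smul]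
      rw [show j + 1 + i = i + (j + 1) by ring])
    (by
      intro i j a b ha hb
      rw [gradedLin_apply _ _ hb, gradedLin_apply _ _ ha]
      simp only [LinearMap.comp_apply, mono_mul, dFn_dFn ha hb, map_smul]
      rw [show j + 1 + (i + 1) = i + 1 + (j + 1) by ring])

/-- Laurent polynomials all of whose coefficients lie in `N`. -/
def coeffIn (N : Submodule ℝ M.Form) : Submodule ℝ (AddMonoidAlgebra M.Form ℤ) :=
  ⨆ i : ℤ, N.map (mono M i)

theorem coeff_mem (N : Submodule ℝ M.Form) {u : AddMonoidAlgebra M.Form ℤ}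
    (hu : u ∈ coeffIn M N) (n : ℤ) : u.coeff n ∈ N := by
  induction hu using Submodule.iSup_induction' with
  | mem i u hu =>
    obtain ⟨x, hx, rfl⟩ := hu
    change (Finsupp.single i x) n ∈ N
    rw [Finsupp.single_apply]
    split_ifs
    · exact hx
    · exact Submodule.zero_mem _
  | zero => exact Submodule.zero_mem _
  | add a b _ _ ha hb =>
    rw [AddMonoidAlgebra.coeff_add, Finsupp.add_apply]
    exact Submodule.add_mem _ ha hb

theorem mono_mem (N : Submodule ℝ M.Form) (i : ℤ) {x : M.Form} (hx : x ∈ N) :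
    mono M i x ∈ coeffIn M N :=
  Submodule.mem_iSup_of_mem i ⟨x, hx, rfl⟩

theorem mul_mem_coeffIn (N N' : Submodule ℝ M.Form) {u v : AddMonoidAlgebra M.Form ℤ}
    (hu : u ∈ coeffIn M N) (hv : v ∈ coeffIn M N') : u * v ∈ coeffIn M (N * N') := by
  have : coeffIn M N * coeffIn M N' ≤ coeffIn M (N * N') := by
    rw [coeffIn, coeffIn, Submodule.iSup_mul]
    refine iSup_le fun i => ?_
    rw [Submodule.mul_iSup]
    refine iSup_le fun j => ?_
    rw [Submodule.mul_le]
    rintro _ ⟨x, hx, rfl⟩ _ ⟨y, hy, rfl⟩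
    rw [mono_mul]
    exact mono_mem M _ _ (Submodule.mul_mem_mul hx hy)
  exact this (Submodule.mul_mem_mul hu hv)

theorem coactK_fn {i : ℤ} {a : M.Fn} (ha : a ∈ M.deg i) :
    coactK M (Kahler.fn M a) = mono M i (ofFn M a) := by
  rw [coactK, Kahler.lift_fn, gradedAlg_apply _ _ _ _ ha]
  rfl

theorem coactK_dd {i : ℤ} {a : M.Fn} (ha : a ∈ M.deg i) :
    coactK M (Kahler.dd M a) = mono M (i + 1) (dFn M a) := by
  rw [coactK, Kahler.lift_dd, gradedLin_apply _ _ ha]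
  rfl

theorem coactK_sub_mem {p : M.Fn →ₐ[ℝ] ℝ} (hp : p ∈ M.points) (x : M.Kahler) :
    coactK M x - (p (Kahler.scalar M x)) • 1 ∈ coeffIn M (maxIdeal (p.comp (scalar M))) := by
  induction x using Kahler.induction with
  | hfn a =>
    have hs : Kahler.scalar M (Kahler.fn M a) = a := by simp [Kahler.scalar]
    rw [hs]
    induction a using M.hom_induction with
    | h0 => simp
    | hadd a b ha hb =>
      have := Submodule.add_mem _ (ha (by simp [Kahler.scalar])) (hb (by simp [Kahler.scalar]))
      rw [map_add, map_add, map_add, add_smul]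
      convert this using 1
      abel
    | hom i a ha =>
      rw [coactK_fn M ha]
      by_cases hi : i = 0
      · subst hi
        rw [← mono_one, ← map_smul, ← map_sub]
        apply mono_mem
        simp [mem_maxIdeal]
      · rw [M.point_deg p hp hi ha, zero_smul, sub_zero]
        apply mono_mem
        rw [mem_maxIdeal]
        simp [M.point_deg p hp hi ha]
  | hdd a =>
    have hs : Kahler.scalar M (Kahler.dd M a) = 0 := by simp [Kahler.scalar]
    rw [hs, map_zero, zero_smul, sub_zero]
    induction a using M.hom_induction with
    | h0 => simp
    | hadd a b ha hb =>
      rw [map_add, map_add]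
      exact Submodule.add_mem _ (ha (by simp [Kahler.scalar])) (hb (by simp [Kahler.scalar]))
    | hom i a ha =>
      rw [coactK_dd M ha]
      apply mono_mem
      simp [mem_maxIdeal]
  | hmul x y hx hy =>
    have h1 := mul_mem_coeffIn M _ _ hx hy
    have h2 : maxIdeal (p.comp (scalar M)) * maxIdeal (p.comp (scalar M)) ≤
        maxIdeal (p.comp (scalar M)) := by
      rw [Submodule.mul_le]
      intro a ha b _
      rw [mem_maxIdeal] at ha ⊢
      rw [map_mul, ha, zero_mul]
    have h3 : coeffIn M (maxIdeal (p.comp (scalar M)) * maxIdeal (p.comp (scalar M))) ≤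
        coeffIn M (maxIdeal (p.comp (scalar M))) :=
      iSup_mono fun i => Submodule.map_mono h2
    have h4 := Submodule.add_mem _ (h3 h1) (Submodule.add_mem _
      (Submodule.smul_mem _ (p (Kahler.scalar M y)) hx)
      (Submodule.smul_mem _ (p (Kahler.scalar M x)) hy))
    convert h4 using 1
    rw [map_mul, map_mul, map_mul]
    simp only [sub_mul, mul_sub, smul_mul_assoc, mul_smul_comm, one_mul, mul_one, smul_sub,
      smul_smul]
    rw [mul_comm (p (Kahler.scalar M y))]
    abel
  | hadd x y hx hy =>
    have := Submodule.add_mem _ hx hy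
    rw [map_add, map_add, map_add, add_smul]
    convert this using 1
    abel

theorem coactK_flat {x : M.Kahler} (hx : x ∈ Kahler.flat M) : coactK M x = 0 := by
  refine AddMonoidAlgebra.ext (Finsupp.ext fun n => ?_)
  refine eq_zero_of_flat M _ fun p hp k => ?_
  refine coeff_mem M _ ?_ n
  refine maxIdeal_pow_map (p.comp (Kahler.scalar M)) (coactK M)
    (fun k => coeffIn M (maxIdeal (p.comp (scalar M)) ^ (k + 1))) ?_ ?_ k (hx p hp k)
  · intro y hy
    have := coactK_sub_mem M hp y
    rw [mem_maxIdeal] at hy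
    change p (Kahler.scalar M y) = 0 at hy
    rw [hy, zero_smul, sub_zero] at this
    rwa [zero_add, Submodule.pow_one]
  · intro k u hu v hv
    rw [zero_add, Submodule.pow_one] at hv
    rw [Submodule.pow_succ]
    exact mul_mem_coeffIn M _ _ hu hv

/-- The coaction recording the total degree of forms. -/
def coact : M.Form →ₐ[ℝ] AddMonoidAlgebra M.Form ℤ :=
  Ideal.Quotient.liftₐ (Kahler.flat M) (coactK M) (fun _ h => coactK_flat M h)

theorem coact_word {n : ℤ} {x : M.Form} (h : Word n x) : coact M x = mono M n x := by
  induction h with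
  | one => rw [map_one, mono_one]
  | fn ha _ ih =>
    rw [map_mul, ih, ← mono_mul]
    congr 1
    exact coactK_fn M ha
  | dd ha _ ih =>
    rw [map_mul, ih, ← mono_mul]
    congr 1
    exact coactK_dd M ha

theorem coact_deg {n : ℤ} {x : M.Form} (h : x ∈ deg M n) : coact M x = mono M n x := by
  induction h using Submodule.span_induction with
  | mem x hx => exact coact_word M hx
  | zero => simp
  | add a b _ _ ha hb => rw [map_add, ha, hb, map_add]
  | smul r a _ ha => rw [map_smul, ha, map_smul]

theorem iSup_deg : ⨆ n, deg M n = ⊤ := by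
  have hmul : (⨆ n, deg M n) * (⨆ n, deg M n) ≤ ⨆ n, deg M n := by
    rw [Submodule.iSup_mul]
    refine iSup_le fun i => ?_
    rw [Submodule.mul_iSup]
    refine iSup_le fun j => ?_
    rw [Submodule.mul_le]
    intro x hx y hy
    exact Submodule.mem_iSup_of_mem _ (mul_mem_deg M hx hy)
  rw [eq_top_iff]
  rintro x -
  induction x using Form.induction with
  | hfn a =>
    induction a using M.hom_induction with
    | h0 => simp
    | hadd a b ha hb => rw [map_add]; exact Submodule.add_mem _ ha hb
    | hom i a ha => exact Submodule.mem_iSup_of_mem _ (mem_deg_of_word M (Word.ofFn ha))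
  | hdd a =>
    induction a using M.hom_induction with
    | h0 => simp
    | hadd a b ha hb => rw [map_add]; exact Submodule.add_mem _ ha hb
    | hom i a ha => exact Submodule.mem_iSup_of_mem _ (mem_deg_of_word M (Word.dFn ha))
  | hmul x y hx hy => exact hmul (Submodule.mul_mem_mul hx hy)
  | hadd x y hx hy => exact Submodule.add_mem _ hx hy

theorem isInternal : DirectSum.IsInternal (deg M) := by
  constructor
  · refine (injective_iff_map_eq_zero _).mpr fun u hu => ?_
    have key : ∀ (u : DirectSum ℤ fun i => deg M i) (n : ℤ),
        (coact M (DirectSum.coeAddMonoidHom (deg M) u)).coeff n = u n := by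
      intro u n
      induction u using DirectSum.induction_on with
      | zero => simp
      | of i x =>
        rw [DirectSum.coeAddMonoidHom_of, coact_deg M x.2]
        change (Finsupp.single i (x : M.Form)) n = _
        rw [Finsupp.single_apply]
        split_ifs with h
        · subst h
          rw [DirectSum.of_eq_same]
        · rw [DirectSum.of_eq_of_ne _ _ _ (Ne.symm h)]
          rfl
      | add a b ha hb =>
        rw [map_add, map_add, AddMonoidAlgebra.coeff_add, Finsupp.add_apply, ha, hb]
        rfl
    ext n
    rw [← key u n, hu]
    simp
  · intro x
    have hx : x ∈ ⨆ n, deg M n := by rw [iSup_deg]; trivial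
    induction hx using Submodule.iSup_induction' with
    | mem i x hx => exact ⟨DirectSum.of _ i ⟨x, hx⟩, DirectSum.coeAddMonoidHom_of _ _ _⟩
    | zero => exact ⟨0, map_zero _⟩
    | add a b _ _ ha hb =>
      obtain ⟨u, rfl⟩ := ha
      obtain ⟨v, rfl⟩ := hb
      exact ⟨u + v, map_add _ _ _⟩

instance : GradedAlgebra (deg M) := DirectSum.IsInternal.gradedAlgebra (isInternal M)

theorem scalar_deg {n : ℤ} {x : M.Form} (h : x ∈ deg M n) : scalar M x ∈ M.deg n := by
  induction h using Submodule.span_induction with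
  | mem x hx =>
    induction hx with
    | one => rw [map_one]; exact SetLike.GradedOne.one_mem
    | fn ha _ ih => rw [map_mul, scalar_ofFn]; exact SetLike.GradedMul.mul_mem ha ih
    | dd ha _ ih => rw [map_mul, scalar_dFn, zero_mul]; exact Submodule.zero_mem _
  | zero => rw [map_zero]; exact Submodule.zero_mem _
  | add a b _ _ ha hb => rw [map_add]; exact Submodule.add_mem _ ha hb
  | smul r a _ ha => rw [map_smul]; exact Submodule.smul_mem _ _ ha

end Form

/-- The shifted tangent bundle `T[1]M`: its functions are the differential forms on `M`, graded by
the sum of form degree and ghost degree; its body is the one of `M`. -/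
def T1 : GradedSpace.{u} where
  Fn := M.Form
  deg := Form.deg M
  gradedComm hx hy := Form.deg_comm M hx hy
  points := {q | ∃ p ∈ M.points, q = p.comp (Form.scalar M)}
  point_deg := by
    rintro _ ⟨p, hp, rfl⟩ i a hi ha
    exact M.point_deg p hp hi (Form.scalar_deg M ha)
  separated x h := Form.eq_zero_of_flat M x fun p hp k => h _ ⟨p, hp, rfl⟩ k

end GradedSpace

namespace GradedSpace

variable (M : GradedSpace.{u})

/-- A function on `M` as a function on `T[1]M`, i.e. as a form of form degree zero. -/
def fn : M.Fn →ₐ[ℝ] M.T1.Fn := Form.ofFn M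

/-- The differential of a function on `M`, as a function on `T[1]M`. -/
def dfn : M.Fn →ₗ[ℝ] M.T1.Fn := Form.dFn M

/-- The component of form degree zero of a form (its restriction to the zero section). -/
def scalar : M.T1.Fn →ₐ[ℝ] M.Fn := Form.scalar M

variable {M}

@[simp] theorem scalar_fn (a : M.Fn) : M.scalar (M.fn a) = a := Form.scalar_ofFn a

@[simp] theorem scalar_dfn (a : M.Fn) : M.scalar (M.dfn a) = 0 := Form.scalar_dFn a

theorem fn_mem {i : ℤ} {a : M.Fn} (ha : a ∈ M.deg i) : M.fn a ∈ M.T1.deg i :=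
  Form.mem_deg_of_word M (Form.Word.ofFn ha)

theorem dfn_mem {i : ℤ} {a : M.Fn} (ha : a ∈ M.deg i) : M.dfn a ∈ M.T1.deg (i + 1) :=
  Form.mem_deg_of_word M (Form.Word.dFn ha)

theorem dfn_mul {i : ℤ} {a : M.Fn} (b : M.Fn) (ha : a ∈ M.deg i) :
    M.dfn (a * b) = M.dfn a * M.fn b + sgn i • (M.fn a * M.dfn b) :=
  Form.dFn_mul b ha

/-- Induction over homogeneous elements. -/
theorem T1_deg_induction {C : ℤ → M.T1.Fn → Prop} (hone : C 0 1) (hzero : ∀ n, C n 0)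
    (hadd : ∀ n x y, C n x → C n y → C n (x + y)) (hsmul : ∀ n (r : ℝ) x, C n x → C n (r • x))
    (hfn : ∀ i n a x, a ∈ M.deg i → x ∈ M.T1.deg n → C n x → C (i + n) (M.fn a * x))
    (hdd : ∀ i n a x, a ∈ M.deg i → x ∈ M.T1.deg n → C n x → C (i + 1 + n) (M.dfn a * x))
    {n : ℤ} {x : M.T1.Fn} (hx : x ∈ M.T1.deg n) : C n x := by
  refine Submodule.span_induction (p := fun x _ => C n x) ?_ (hzero n)
    (fun x y _ _ hx hy => hadd n x y hx hy) (fun r x _ hx => hsmul n r x hx) hx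
  clear hx
  intro x hx
  induction hx with
  | one => exact hone
  | fn ha hw ih => exact hfn _ _ _ _ ha (Form.mem_deg_of_word M hw) ih
  | dd ha hw ih => exact hdd _ _ _ _ ha (Form.mem_deg_of_word M hw) ih

/-- The class of a Kähler form. -/
def toForm (M : GradedSpace.{u}) : M.Kahler →ₐ[ℝ] M.T1.Fn := Ideal.Quotient.mkₐ ℝ (Kahler.flat M)

theorem toForm_surjective : Function.Surjective M.toForm :=
  Ideal.Quotient.mkₐ_surjective ℝ (Kahler.flat M)

theorem toForm_flat {x : M.Kahler} (hx : x ∈ Kahler.flat M) : M.toForm x = 0 :=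
  Ideal.Quotient.eq_zero_iff_mem.mpr hx

/-- The algebra map out of forms induced by one which kills the flat Kähler forms. -/
def desc {T : Type*} [Ring T] [Algebra ℝ T] (Ψ : M.Kahler →ₐ[ℝ] T)
    (h : ∀ x ∈ Kahler.flat M, Ψ x = 0) : M.T1.Fn →ₐ[ℝ] T :=
  Ideal.Quotient.liftₐ (Kahler.flat M) Ψ h

theorem desc_toForm {T : Type*} [Ring T] [Algebra ℝ T] (Ψ : M.Kahler →ₐ[ℝ] T)
    (h : ∀ x ∈ Kahler.flat M, Ψ x = 0) (x : M.Kahler) : desc Ψ h (M.toForm x) = Ψ x := rfl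

theorem toForm_fn (a : M.Fn) : M.toForm (Kahler.fn M a) = M.fn a := rfl

theorem toForm_dd (a : M.Fn) : M.toForm (Kahler.dd M a) = M.dfn a := rfl

/-- The projection `T[1]M → M`. -/
def T1.proj (M : GradedSpace.{u}) : Hom M.T1 M where
  pull := M.fn
  map_deg h := fn_mem h
  map_points := by
    rintro _ ⟨p, hp, rfl⟩
    convert hp using 1
    ext a
    change p (Form.scalar M (Form.ofFn M a)) = p a
    rw [Form.scalar_ofFn]

variable {S : GradedSpace.{v}}


/-- The algebra map out of Kähler forms given by a map `f : S → M` and a degree one vector field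
along it. -/
def T1.liftK (f : Hom S M) (δ : VectorAlong f 1) : M.Kahler →ₐ[ℝ] S.Fn :=
  Kahler.lift f.pull δ.toFun
    (by intro i a b ha; simpa using δ.leibniz ha b)
    (fun ha hb => S.gradedComm (f.map_deg ha) (δ.map_deg hb))
    (fun ha hb => S.gradedComm (δ.map_deg ha) (δ.map_deg hb))

theorem T1.liftK_fn (f : Hom S M) (δ : VectorAlong f 1) (a : M.Fn) :
    T1.liftK f δ (Kahler.fn M a) = f.pull a := Kahler.lift_fn ..

theorem T1.liftK_dd (f : Hom S M) (δ : VectorAlong f 1) (a : M.Fn) :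
    T1.liftK f δ (Kahler.dd M a) = δ.toFun a := Kahler.lift_dd ..

theorem T1.liftK_point (f : Hom S M) (δ : VectorAlong f 1) {q : S.Fn →ₐ[ℝ] ℝ}
    (h0 : ∀ a, q (δ.toFun a) = 0) (y : M.Kahler) :
    q (T1.liftK f δ y) = q (f.pull (Kahler.scalar M y)) := by
  induction y using Kahler.induction with
  | hfn a => simp [T1.liftK_fn, Kahler.scalar]
  | hdd a => simp [T1.liftK_dd, Kahler.scalar, h0 a]
  | hmul x y hx hy => simp only [map_mul, hx, hy]
  | hadd x y hx hy => simp only [map_add, hx, hy]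

theorem T1.liftK_flat (f : Hom S M) (δ : VectorAlong f 1)
    (h0 : ∀ q ∈ S.points, ∀ a, q (δ.toFun a) = 0) (x : M.Kahler) (hx : x ∈ Kahler.flat M) :
    T1.liftK f δ x = 0 := by
  refine S.separated _ fun q hq k => ?_
  have hp := f.map_points q hq
  refine maxIdeal_pow_map ((q.comp f.pull).comp (Kahler.scalar M)) (T1.liftK f δ)
    (fun k => maxIdeal q ^ (k + 1)) ?_ ?_ k (hx _ hp k)
  · intro y hy
    rw [zero_add, Submodule.pow_one, mem_maxIdeal, T1.liftK_point f δ (h0 q hq)]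
    exact hy
  · intro k x hx y hy
    rw [zero_add, Submodule.pow_one] at hy
    rw [Submodule.pow_succ]
    exact Submodule.mul_mem_mul hx hy

/-- The map `S → T[1]M` given by a map `f : S → M` and a degree one vector field along it whose
components vanish at the points of `S`. -/
def T1.lift (f : Hom S M) (δ : VectorAlong f 1) (h0 : ∀ q ∈ S.points, ∀ a, q (δ.toFun a) = 0) :
    Hom S M.T1 where
  pull := desc (T1.liftK f δ) (T1.liftK_flat f δ h0)
  map_deg := by
    generalize hΨ : desc (T1.liftK f δ) (T1.liftK_flat f δ h0) = Ψ
    have h1 : ∀ a, Ψ (M.fn a) = f.pull a := by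
      intro a; rw [← hΨ, ← toForm_fn, desc_toForm, T1.liftK_fn]
    have h2 : ∀ a, Ψ (M.dfn a) = δ.toFun a := by
      intro a; rw [← hΨ, ← toForm_dd, desc_toForm, T1.liftK_dd]
    intro n x hx
    refine T1_deg_induction (M := M) (C := fun n x => Ψ x ∈ S.deg n) ?_ ?_ ?_ ?_ ?_ ?_ hx
    · rw [map_one]; exact SetLike.GradedOne.one_mem
    · intro n; rw [map_zero]; exact Submodule.zero_mem _
    · intro n x y hx hy; rw [map_add]; exact Submodule.add_mem _ hx hy
    · intro n r x hx; rw [map_smul]; exact Submodule.smul_mem _ _ hx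
    · intro i n a x ha _ hx
      rw [map_mul, h1]
      exact SetLike.GradedMul.mul_mem (f.map_deg ha) hx
    · intro i n a x ha _ hx
      rw [map_mul, h2]
      exact SetLike.GradedMul.mul_mem (δ.map_deg ha) hx
  map_points := by
    intro q hq
    refine ⟨q.comp f.pull, f.map_points q hq, ?_⟩
    refine AlgHom.ext fun x => ?_
    obtain ⟨y, rfl⟩ := M.toForm_surjective x
    exact T1.liftK_point f δ (h0 q hq) y

theorem T1.lift_fn (f : Hom S M) (δ : VectorAlong f 1) (h0) (a : M.Fn) :
    (T1.lift f δ h0).pull (M.fn a) = f.pull a := T1.liftK_fn f δ a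

theorem T1.lift_dfn (f : Hom S M) (δ : VectorAlong f 1) (h0) (a : M.Fn) :
    (T1.lift f δ h0).pull (M.dfn a) = δ.toFun a := T1.liftK_dd f δ a

/-- The map `T[1]φ : T[1]M → T[1]N`, whose pullback is the pullback of differential forms. -/
def T1.map {N : GradedSpace.{w}} (φ : Hom M N) : Hom M.T1 N.T1 :=
  T1.lift (φ.comp (T1.proj M))
    { toFun := M.dfn ∘ₗ φ.pull.toLinearMap
      map_deg := fun h => dfn_mem (φ.map_deg h)
      leibniz := by
        intro i a ha b
        change M.dfn (φ.pull (a * b)) = M.dfn (φ.pull a) * M.fn (φ.pull b) +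
          sgn (1 * i) • (M.fn (φ.pull a) * M.dfn (φ.pull b))
        rw [map_mul, dfn_mul _ (φ.map_deg ha), one_mul] }
    (by
      rintro _ ⟨p, _, rfl⟩ a
      change p (M.scalar (M.dfn (φ.pull a))) = 0
      rw [scalar_dfn, map_zero])

theorem T1.map_fn {N : GradedSpace.{w}} (φ : Hom M N) (a : N.Fn) :
    (T1.map φ).pull (N.fn a) = M.fn (φ.pull a) :=
  T1.lift_fn _ _ _ a

theorem T1.map_dfn {N : GradedSpace.{w}} (φ : Hom M N) (a : N.Fn) :
    (T1.map φ).pull (N.dfn a) = M.dfn (φ.pull a) :=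
  T1.lift_dfn _ _ _ a

theorem fn_leibniz_ext {T : Type*} [Ring T] [Algebra ℝ T] (F : M.Fn →ₗ[ℝ] T) (f g : M.Fn →ₗ[ℝ] T)
    (P : M.Fn →ₗ[ℝ] T)
    (h : ∀ {i : ℤ} {a : M.Fn}, a ∈ M.deg i → ∀ b, F (a * b) = g a * f b + P a * F b) (a b : M.Fn) :
    F (a * b) = g a * f b + P a * F b := by
  induction a using M.hom_induction with
  | h0 => simp
  | hadd a c ha hc => simp only [add_mul, map_add, ha, hc]; abel
  | hom i a ha => exact h ha b

/-- Data on generators determining a vector field of degree `k` along a map `Φ : S → T[1]M`: its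
values `A a` on the functions `a` and `B a` on the differentials `d a`. -/
structure T1.VecData (Φ : Hom S M.T1) (k : ℤ) where
  A : M.Fn →ₗ[ℝ] S.Fn
  B : M.Fn →ₗ[ℝ] S.Fn
  A_deg : ∀ {i : ℤ} {a : M.Fn}, a ∈ M.deg i → A a ∈ S.deg (i + k)
  B_deg : ∀ {i : ℤ} {a : M.Fn}, a ∈ M.deg i → B a ∈ S.deg (i + 1 + k)
  A_mul : ∀ {i : ℤ} {a : M.Fn}, a ∈ M.deg i → ∀ b : M.Fn,
    A (a * b) = A a * Φ.pull (M.fn b) + sgn (k * i) • (Φ.pull (M.fn a) * A b)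
  B_mul : ∀ {i : ℤ} {a : M.Fn}, a ∈ M.deg i → ∀ b : M.Fn,
    B (a * b) = B a * Φ.pull (M.fn b) + sgn (k * (i + 1)) • (Φ.pull (M.dfn a) * A b) +
      sgn i • (A a * Φ.pull (M.dfn b) + sgn (k * i) • (Φ.pull (M.fn a) * B b))

namespace T1.VecData

variable {Φ : Hom S M.T1} {k : ℤ} (D : T1.VecData Φ k)

/-- The upper triangular matrix with diagonal entries `(-1)^{k |r|} r`, `r` and corner `t`. -/
def tri (S : GradedSpace.{v}) (k : ℤ) (r t : S.Fn) : Matrix (Fin 2) (Fin 2) S.Fn :=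
  !![S.parity k r, t; 0, r]

theorem tri_mul (r t r' t' : S.Fn) :
    tri S k r t * tri S k r' t' = tri S k (r * r') (t * r' + S.parity k r * t') := by
  ext i j
  fin_cases i <;> fin_cases j <;> simp [tri, Matrix.mul_apply, Fin.sum_univ_two, add_comm]

theorem tri_add (r t r' t' : S.Fn) :
    tri S k r t + tri S k r' t' = tri S k (r + r') (t + t') := by
  ext i j
  fin_cases i <;> fin_cases j <;> simp [tri]

theorem tri_smul (c : ℝ) (r t : S.Fn) : c • tri S k r t = tri S k (c • r) (c • t) := by
  ext i j
  fin_cases i <;> fin_cases j <;> simp [tri]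

theorem tri_comm {i j : ℤ} {r t r' t' : S.Fn} (hr : r ∈ S.deg i) (ht : t ∈ S.deg (i + k))
    (hr' : r' ∈ S.deg j) (ht' : t' ∈ S.deg (j + k)) :
    tri S k r t * tri S k r' t' = sgn (i * j) • (tri S k r' t' * tri S k r t) := by
  rw [tri_mul, tri_mul, tri_smul, S.parity_apply k hr, S.parity_apply k hr', S.gradedComm hr hr']
  congr 1
  rw [smul_add, smul_mul_assoc, smul_mul_assoc, S.gradedComm ht hr', S.gradedComm hr ht', smul_smul,
    smul_smul, ← sgn_add, ← sgn_add, add_comm (sgn _ • _)]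
  have e : sgn (k * i + i * (j + k)) = sgn (i * j) := by
    rw [show k * i + i * (j + k) = i * j + (k * i + k * i) by ring, sgn_add, sgn_add (k * i),
      sgn_mul_self, mul_one]
  rw [e, show (i + k) * j = i * j + k * j by ring]

def matFn : M.Fn →ₐ[ℝ] Matrix (Fin 2) (Fin 2) S.Fn :=
  AlgHom.ofLinearMap
    { toFun := fun a => tri S k (Φ.pull (M.fn a)) (D.A a)
      map_add' := fun a b => by rw [tri_add]; simp only [map_add]
      map_smul' := fun c a => by rw [RingHom.id_apply, tri_smul]; simp only [map_smul] }
    (by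
      have h1 := D.A_mul (i := 0) (a := 1) SetLike.GradedOne.one_mem 1
      simp only [mul_one, mul_zero, sgn_zero, one_smul, map_one, one_mul] at h1
      have h2 : D.A 1 = 0 := by simpa using h1
      change tri S k (Φ.pull (M.fn 1)) (D.A 1) = 1
      rw [h2, map_one, map_one]
      ext i j
      fin_cases i <;> fin_cases j <;> simp [tri])
    (by
      intro a b
      change tri S k (Φ.pull (M.fn (a * b))) (D.A (a * b)) =
        tri S k (Φ.pull (M.fn a)) (D.A a) * tri S k (Φ.pull (M.fn b)) (D.A b)
      rw [tri_mul, map_mul, map_mul]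
      congr 1
      refine fn_leibniz_ext D.A (Φ.pull.toLinearMap ∘ₗ M.fn.toLinearMap) D.A
        ((S.parity k).toLinearMap ∘ₗ Φ.pull.toLinearMap ∘ₗ M.fn.toLinearMap) ?_ a b
      intro i a ha b
      rw [D.A_mul ha]
      change _ = D.A a * Φ.pull (M.fn b) + S.parity k (Φ.pull (M.fn a)) * D.A b
      rw [S.parity_apply k (Φ.map_deg (fn_mem ha)), smul_mul_assoc])

def matD : M.Fn →ₗ[ℝ] Matrix (Fin 2) (Fin 2) S.Fn where
  toFun a := tri S k (Φ.pull (M.dfn a)) (D.B a)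
  map_add' a b := by rw [tri_add]; simp only [map_add]
  map_smul' c a := by rw [RingHom.id_apply, tri_smul]; simp only [map_smul]

def matK : M.Kahler →ₐ[ℝ] Matrix (Fin 2) (Fin 2) S.Fn :=
  Kahler.lift D.matFn D.matD
    (by
      intro i a b ha
      change tri S k (Φ.pull (M.dfn (a * b))) (D.B (a * b)) =
        tri S k (Φ.pull (M.dfn a)) (D.B a) * tri S k (Φ.pull (M.fn b)) (D.A b) +
        sgn i • (tri S k (Φ.pull (M.fn a)) (D.A a) * tri S k (Φ.pull (M.dfn b)) (D.B b))
      rw [tri_mul, tri_mul, tri_smul, tri_add, dfn_mul b ha, map_add, map_smul, map_mul, map_mul,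
        D.B_mul ha, S.parity_apply k (Φ.map_deg (fn_mem ha)),
        S.parity_apply k (Φ.map_deg (dfn_mem ha)), smul_mul_assoc, smul_mul_assoc])
    (fun ha hb => tri_comm (Φ.map_deg (fn_mem ha)) (D.A_deg ha) (Φ.map_deg (dfn_mem hb))
      (D.B_deg hb))
    (fun ha hb => tri_comm (Φ.map_deg (dfn_mem ha)) (D.B_deg ha) (Φ.map_deg (dfn_mem hb))
      (D.B_deg hb))

theorem matK_eq (y : M.Kahler) : ∃ t, D.matK y =
    tri S k (Φ.pull (M.toForm y)) t := by
  induction y using Kahler.induction with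
  | hfn a => exact ⟨D.A a, Kahler.lift_fn ..⟩
  | hdd a => exact ⟨D.B a, Kahler.lift_dd ..⟩
  | hmul x y hx hy =>
    obtain ⟨s, hs⟩ := hx
    obtain ⟨t, ht⟩ := hy
    refine ⟨s * Φ.pull (M.toForm y) + S.parity k (Φ.pull (M.toForm x)) * t, ?_⟩
    rw [map_mul, hs, ht, tri_mul, map_mul, map_mul]
  | hadd x y hx hy =>
    obtain ⟨s, hs⟩ := hx
    obtain ⟨t, ht⟩ := hy
    refine ⟨s + t, ?_⟩
    rw [map_add, hs, ht, tri_add, map_add, map_add]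

/-- The filtration used to see that flat forms are sent to zero. -/
def filt (S : GradedSpace.{v}) (q : S.Fn →ₐ[ℝ] ℝ) (n : ℕ) :
    Submodule ℝ (Matrix (Fin 2) (Fin 2) S.Fn) where
  carrier := {m | m 0 0 ∈ maxIdeal q ^ (n + 1) ∧ m 1 1 ∈ maxIdeal q ^ (n + 1) ∧ m 1 0 = 0 ∧
    (n = 0 ∨ m 0 1 ∈ maxIdeal q ^ n)}
  zero_mem' := ⟨Submodule.zero_mem _, Submodule.zero_mem _, rfl, Or.inr (Submodule.zero_mem _)⟩
  add_mem' := by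
    rintro a b ⟨h1, h2, h3, h4⟩ ⟨g1, g2, g3, g4⟩
    refine ⟨Submodule.add_mem _ h1 g1, Submodule.add_mem _ h2 g2, ?_, ?_⟩
    · rw [Matrix.add_apply, h3, g3, add_zero]
    · rcases h4 with h4 | h4
      · exact Or.inl h4
      rcases g4 with g4 | g4
      · exact Or.inl g4
      exact Or.inr (Submodule.add_mem _ h4 g4)
  smul_mem' := by
    rintro c a ⟨h1, h2, h3, h4⟩
    refine ⟨Submodule.smul_mem _ _ h1, Submodule.smul_mem _ _ h2, ?_, ?_⟩
    · rw [Matrix.smul_apply, h3, smul_zero]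
    · exact h4.imp id (Submodule.smul_mem _ _)

theorem filt_mul (q : S.Fn →ₐ[ℝ] ℝ) (n : ℕ) {x y : Matrix (Fin 2) (Fin 2) S.Fn}
    (hx : x ∈ filt S q n) (hy : y ∈ filt S q 0) : x * y ∈ filt S q (n + 1) := by
  obtain ⟨h1, h2, h3, h4⟩ := hx
  obtain ⟨g1, g2, g3, -⟩ := hy
  rw [zero_add, Submodule.pow_one] at g1 g2
  refine ⟨?_, ?_, ?_, Or.inr ?_⟩
  · rw [Matrix.mul_apply, Fin.sum_univ_two, g3, mul_zero, add_zero, Submodule.pow_succ]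
    exact Submodule.mul_mem_mul h1 g1
  · rw [Matrix.mul_apply, Fin.sum_univ_two, h3, zero_mul, zero_add, Submodule.pow_succ]
    exact Submodule.mul_mem_mul h2 g2
  · rw [Matrix.mul_apply, Fin.sum_univ_two, h3, zero_mul, zero_add, g3, mul_zero]
  · rw [Matrix.mul_apply, Fin.sum_univ_two]
    refine Submodule.add_mem _ (maxIdeal_mul_right q n h1 _) ?_
    rcases h4 with rfl | h4
    · rw [zero_add, Submodule.pow_one, mem_maxIdeal, map_mul, mem_maxIdeal.mp g2, mul_zero]
    · rw [Submodule.pow_succ]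
      exact Submodule.mul_mem_mul h4 g2

theorem matK_flat {x : M.Kahler} (hx : x ∈ Kahler.flat M) : D.matK x = 0 := by
  obtain ⟨t, ht⟩ := D.matK_eq x
  have hx0 : M.toForm x = 0 :=
    toForm_flat hx
  have ht0 : t = 0 := by
    refine S.separated _ fun q hq k' => ?_
    obtain ⟨p, hp, hpq⟩ := Φ.map_points q hq
    have := maxIdeal_pow_map (p.comp (Kahler.scalar M)) D.matK (filt S q) ?_
      (fun n x hx y hy => filt_mul q n hx hy) (k' + 1) (hx p hp (k' + 1))
    · obtain ⟨-, -, -, h⟩ := this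
      rw [ht] at h
      simpa [tri] using h
    · intro y hy
      obtain ⟨s, hs⟩ := D.matK_eq y
      have h0 : q (Φ.pull (M.toForm y)) = 0 := by
        have := DFunLike.congr_fun hpq (M.toForm y)
        exact this.trans hy
      rw [hs]
      refine ⟨?_, ?_, rfl, Or.inl rfl⟩
      · rw [zero_add, Submodule.pow_one, mem_maxIdeal]
        change q (S.parity k _) = 0
        rw [S.point_parity k hq, h0]
      · rw [zero_add, Submodule.pow_one]
        exact h0
  rw [ht, hx0, ht0]
  change tri S k (Φ.pull 0) 0 = 0
  rw [map_zero]
  ext i j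
  fin_cases i <;> fin_cases j <;> simp [tri]

def mat : M.T1.Fn →ₐ[ℝ] Matrix (Fin 2) (Fin 2) S.Fn :=
  desc D.matK (fun _ h => D.matK_flat h)

/-- The value of the vector field on functions on `T[1]M`. -/
def toLin : M.T1.Fn →ₗ[ℝ] S.Fn where
  toFun x := D.mat x 0 1
  map_add' x y := by rw [map_add]; rfl
  map_smul' c x := by rw [map_smul]; rfl

theorem mat_eq (x : M.T1.Fn) : D.mat x = tri S k (Φ.pull x) (D.toLin x) := by
  obtain ⟨y, rfl⟩ := M.toForm_surjective x
  obtain ⟨t, ht⟩ := D.matK_eq y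
  have h : D.mat (M.toForm y) =
    tri S k (Φ.pull (M.toForm y)) t := ht
  have h2 : D.toLin (M.toForm y) = t := by
    have := congrFun (congrFun h 0) 1
    exact this
  rw [h2]
  exact h

theorem toLin_mul (x y : M.T1.Fn) :
    D.toLin (x * y) = D.toLin x * Φ.pull y + S.parity k (Φ.pull x) * D.toLin y := by
  have h : D.mat (x * y) = D.mat x * D.mat y := map_mul _ _ _
  rw [D.mat_eq, D.mat_eq, D.mat_eq, tri_mul] at h
  exact congrFun (congrFun h 0) 1

theorem toLin_fn (a : M.Fn) : D.toLin (M.fn a) = D.A a := by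
  have h : D.matK (Kahler.fn M a) = tri S k (Φ.pull (M.fn a)) (D.A a) := Kahler.lift_fn ..
  exact congrFun (congrFun h 0) 1

theorem toLin_dfn (a : M.Fn) : D.toLin (M.dfn a) = D.B a := by
  have h : D.matK (Kahler.dd M a) = tri S k (Φ.pull (M.dfn a)) (D.B a) := Kahler.lift_dd ..
  exact congrFun (congrFun h 0) 1

/-- The vector field along `Φ` with the given values on generators. -/
def vec : VectorAlong Φ k where
  toFun := D.toLin
  map_deg := by
    intro n x hx
    refine T1_deg_induction (M := M) (C := fun n x => D.toLin x ∈ S.deg (n + k))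
      ?_ ?_ ?_ ?_ ?_ ?_ hx
    · have h := D.toLin_mul 1 1
      rw [map_one Φ.pull, map_one (S.parity k), mul_one, mul_one, one_mul] at h
      have h2 : D.toLin 1 = 0 := by simpa using h
      rw [h2]
      exact Submodule.zero_mem _
    · intro n; rw [map_zero]; exact Submodule.zero_mem _
    · intro n x y hx hy; rw [map_add]; exact Submodule.add_mem _ hx hy
    · intro n r x hx; rw [map_smul]; exact Submodule.smul_mem _ _ hx
    · intro i n a x ha hx ih
      rw [D.toLin_mul, D.toLin_fn, S.parity_apply k (Φ.map_deg (fn_mem ha)), smul_mul_assoc]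
      refine Submodule.add_mem _ ?_ (Submodule.smul_mem _ _ ?_)
      · have := SetLike.GradedMul.mul_mem (D.A_deg ha) (Φ.map_deg hx)
        rwa [show i + k + n = i + n + k by ring] at this
      · have := SetLike.GradedMul.mul_mem (Φ.map_deg (fn_mem ha)) ih
        rwa [show i + (n + k) = i + n + k by ring] at this
    · intro i n a x ha hx ih
      rw [D.toLin_mul, D.toLin_dfn, S.parity_apply k (Φ.map_deg (dfn_mem ha)), smul_mul_assoc]
      refine Submodule.add_mem _ ?_ (Submodule.smul_mem _ _ ?_)
      · have := SetLike.GradedMul.mul_mem (D.B_deg ha) (Φ.map_deg hx)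
        rwa [show i + 1 + k + n = i + 1 + n + k by ring] at this
      · have := SetLike.GradedMul.mul_mem (Φ.map_deg (dfn_mem ha)) ih
        rwa [show i + 1 + (n + k) = i + 1 + n + k by ring] at this
  leibniz := by
    intro i x hx y
    rw [D.toLin_mul, S.parity_apply k (Φ.map_deg hx), smul_mul_assoc]

end T1.VecData

end GradedSpace

namespace GradedSpace

/-! ### Cartan calculus -/

section Cartan

variable (M : GradedSpace.{u})

/-- The de Rham differential, as a vector field of degree `1` on `T[1]M`: it sends `f` to `d f`
and `d f` to `0`. -/
def deRham : VectorField M.T1 1 :=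
  T1.VecData.vec (Φ := Hom.id M.T1)
    { A := M.dfn
      B := 0
      A_deg := fun ha => dfn_mem ha
      B_deg := fun _ => Submodule.zero_mem _
      A_mul := fun ha b => by rw [one_mul]; exact dfn_mul b ha
      B_mul := fun {i a} ha b => by
        change (0 : M.T1.Fn) = 0 * M.fn b + sgn (1 * (i + 1)) • (M.dfn a * M.dfn b) +
          sgn i • (M.dfn a * M.dfn b + sgn (1 * i) • (M.fn a * 0))
        rw [one_mul, sgn_add, sgn_one]
        simp }

/-- The differential of a form. -/
def d (x : M.T1.Fn) : M.T1.Fn := M.deRham.toFun x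

variable {M}

theorem d_fn (a : M.Fn) : M.d (M.fn a) = M.dfn a := T1.VecData.toLin_fn _ a

theorem d_dfn (a : M.Fn) : M.d (M.dfn a) = 0 := T1.VecData.toLin_dfn _ a

variable {k : ℤ}

/-- The contraction `i_V` with a vector field `V` of degree `k`: the derivation of degree `k - 1`
of the algebra of forms which sends `f` to `0` and `d f` to `V f`. -/
def contraction (V : VectorField M k) : VectorField M.T1 (k - 1) :=
  T1.VecData.vec (Φ := Hom.id M.T1)
    { A := 0
      B := M.fn.toLinearMap ∘ₗ V.toFun
      A_deg := fun _ => Submodule.zero_mem _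
      B_deg := fun {i a} ha => by
        have := fn_mem (V.map_deg ha)
        rwa [show i + k = i + 1 + (k - 1) by ring] at this
      A_mul := fun _ b => by simp
      B_mul := fun {i a} ha b => by
        change M.fn (V.toFun (a * b)) = M.fn (V.toFun a) * M.fn b +
          sgn ((k - 1) * (i + 1)) • (M.dfn a * 0) +
          sgn i • (0 * M.dfn b + sgn ((k - 1) * i) • (M.fn a * M.fn (V.toFun b)))
        rw [V.leibniz_field ha, map_add, map_smul, map_mul, map_mul, mul_zero, zero_mul, smul_zero,
          add_zero, zero_add, smul_smul, ← sgn_add, show i + (k - 1) * i = k * i by ring] }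

/-- The contraction `i_V x`. -/
def contract (V : VectorField M k) (x : M.T1.Fn) : M.T1.Fn := (contraction V).toFun x

theorem contract_fn (V : VectorField M k) (a : M.Fn) : contract V (M.fn a) = 0 :=
  T1.VecData.toLin_fn _ a

theorem contract_dfn (V : VectorField M k) (a : M.Fn) :
    contract V (M.dfn a) = M.fn (V.toFun a) :=
  T1.VecData.toLin_dfn _ a

/-- The Lie derivative `L_V = i_V d + (-1)^{|V|} d i_V`. -/
def lie (V : VectorField M k) (x : M.T1.Fn) : M.T1.Fn :=
  contract V (M.d x) + sgn k • M.d (contract V x)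

/-- The pullback of differential forms along a map. -/
def pullForm {N : GradedSpace.{v}} (φ : Hom M N) (x : N.T1.Fn) : M.T1.Fn := (T1.map φ).pull x

/-- The infinitesimal change of the pullback of forms when the pullback of functions `φ^*` is
changed by `δ`: the coefficient of `ε` in the pullback of forms along the infinitesimally deformed
map `φ^* + ε δ`, `ε² = 0`.  It is the derivation along the pullback of forms which sends `f` to
`δ f` and `d f` to `d (δ f)`. -/
def formVariation {N : GradedSpace.{v}} {φ : Hom M N} (δ : VectorAlong φ 0) :
    VectorAlong (T1.map φ) 0 :=
  T1.VecData.vec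
    { A := M.fn.toLinearMap ∘ₗ δ.toFun
      B := M.dfn ∘ₗ δ.toFun
      A_deg := fun ha => fn_mem (δ.map_deg ha)
      B_deg := fun {i a} ha => by
        have := dfn_mem (δ.map_deg ha)
        rwa [show i + 0 + 1 = i + 1 + 0 by ring] at this
      A_mul := fun {i a} ha b => by
        have := δ.leibniz ha b
        rw [zero_mul, sgn_zero, one_smul] at this
        simp only [LinearMap.comp_apply, AlgHom.toLinearMap_apply]
        rw [this, map_add, map_mul, map_mul, T1.map_fn, T1.map_fn, zero_mul, sgn_zero, one_smul]
      B_mul := fun {i a} ha b => by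
        have := δ.leibniz ha b
        rw [zero_mul, sgn_zero, one_smul] at this
        have h1 := δ.map_deg ha
        rw [add_zero] at h1
        simp only [LinearMap.comp_apply, AlgHom.toLinearMap_apply]
        rw [this, map_add, dfn_mul _ h1, dfn_mul _ (φ.map_deg ha), T1.map_fn, T1.map_fn, T1.map_dfn,
          T1.map_dfn, zero_mul, zero_mul, sgn_zero, one_smul, one_smul, smul_add]
        abel }

theorem formVariation_fn {N : GradedSpace.{v}} {φ : Hom M N} (δ : VectorAlong φ 0) (a : N.Fn) :
    (formVariation δ).toFun (N.fn a) = M.fn (δ.toFun a) :=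
  T1.VecData.toLin_fn _ a

theorem formVariation_dfn {N : GradedSpace.{v}} {φ : Hom M N} (δ : VectorAlong φ 0) (a : N.Fn) :
    (formVariation δ).toFun (N.dfn a) = M.dfn (δ.toFun a) :=
  T1.VecData.toLin_dfn _ a

variable (M)

/-- The forms of form degree `k`, spanned by the products `f * d g₁ * ⋯ * d g_k`. -/
def formsOfDegree (k : ℕ) : Submodule ℝ M.T1.Fn :=
  LinearMap.range M.fn.toLinearMap * LinearMap.range M.dfn ^ k

/-- The `k`-forms of ghost degree `g`. -/
def forms (k : ℕ) (g : ℤ) : Submodule ℝ M.T1.Fn := M.formsOfDegree k ⊓ M.T1.deg (k + g)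

end Cartan

end GradedSpace

/-! ### Spacetime -/

section Spacetime

/-- The grading of an algebra concentrated in degree zero. -/
def trivialDeg (A : Type u) [Ring A] [Algebra ℝ A] (i : ℤ) : Submodule ℝ A := if i = 0 then ⊤ else ⊥

theorem eq_zero_of_mem_trivialDeg {A : Type u} [Ring A] [Algebra ℝ A] {i : ℤ} (hi : i ≠ 0) {a : A}
    (ha : a ∈ trivialDeg A i) : a = 0 := by
  rw [trivialDeg, if_neg hi] at ha
  exact ha

instance (A : Type u) [Ring A] [Algebra ℝ A] : GradedAlgebra (trivialDeg A) where
  one_mem := by simp [trivialDeg]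
  mul_mem i j a b ha hb := by
    by_cases hi : i = 0
    · by_cases hj : j = 0
      · simp [trivialDeg, hi, hj]
      · rw [eq_zero_of_mem_trivialDeg hj hb, mul_zero]
        exact Submodule.zero_mem _
    · rw [eq_zero_of_mem_trivialDeg hi ha, zero_mul]
      exact Submodule.zero_mem _
  decompose' a := DirectSum.of (fun i => trivialDeg A i) 0 ⟨a, by simp [trivialDeg]⟩
  left_inv a := by rw [DirectSum.coeAddMonoidHom_of]
  right_inv u := by
    induction u using DirectSum.induction_on with
    | zero =>
      rw [map_zero]
      exact map_zero (DirectSum.of (fun i => trivialDeg A i) 0)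
    | of i x =>
      rw [DirectSum.coeAddMonoidHom_of]
      by_cases hi : i = 0
      · subst hi
        rfl
      · have hx : x = 0 := Subtype.ext (eq_zero_of_mem_trivialDeg hi x.2)
        subst hx
        rw [map_zero]
        exact map_zero (DirectSum.of (fun i => trivialDeg A i) 0)
    | add a b ha hb =>
      rw [map_add]
      refine Eq.trans ?_ (congrArg₂ (· + ·) ha hb)
      exact map_add (DirectSum.of (fun i => trivialDeg A i) 0)
        (⟨DirectSum.coeAddMonoidHom _ a, by simp [trivialDeg]⟩ : trivialDeg A 0)
        ⟨DirectSum.coeAddMonoidHom _ b, by simp [trivialDeg]⟩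

variable (n : ℕ) (X : Type u) [TopologicalSpace X] [ChartedSpace (EuclideanSpace ℝ (Fin n)) X]

/-- Evaluation of smooth functions at a point. -/
def evalAt (x : X) : C^∞⟮𝓡 n, X; ℝ⟯ →ₐ[ℝ] ℝ :=
  { (ContMDiffMap.evalRingHom x : C^∞⟮𝓡 n, X; ℝ⟯ →+* ℝ) with commutes' := fun _ => rfl }

/-- A smooth manifold as a graded space: smooth functions in ghost degree zero, with the
evaluations at the points of `X`. -/
def ofManifold : GradedSpace.{u} where
  Fn := C^∞⟮𝓡 n, X; ℝ⟯
  deg := trivialDeg _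
  gradedComm {i j a b} ha hb := by
    by_cases hi : i = 0
    · rw [hi, zero_mul, sgn_zero, one_smul, mul_comm]
    · rw [eq_zero_of_mem_trivialDeg hi ha, zero_mul, mul_zero, smul_zero]
  points := Set.range (evalAt n X)
  point_deg p _ {i a} hi ha := by rw [eq_zero_of_mem_trivialDeg hi ha, map_zero]
  separated a h := by
    refine ContMDiffMap.ext fun x => ?_
    have := h _ ⟨x, rfl⟩ 0
    rw [zero_add, Submodule.pow_one] at this
    exact this

/-- The shifted tangent bundle `T[1]X` of the spacetime: functions on it are the differential forms
on `X`, the ghost degree being the form degree. -/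
def T1X : GradedSpace.{u} := (ofManifold n X).T1

/-- The de Rham differential of `X` as a vector field of degree `1` on `T[1]X`. -/
def dX : VectorField (T1X n X) 1 := (ofManifold n X).deRham

end Spacetime

/-! ### Gauge PDEs over background -/

section GaugePDE

open GradedSpace

/-- The vector field `V` on `M` is projectable along `φ : M → N` with projection `v`. -/
def ProjectsTo {M : GradedSpace.{u}} {N : GradedSpace.{v}} (φ : Hom M N) {k : ℤ}
    (V : VectorField M k) (v : VectorField N k) : Prop :=
  ∀ f : N.Fn, V.toFun (φ.pull f) = φ.pull (v.toFun f)

/-- A distribution: a finitely generated `C^∞(M)`-submodule of vector fields. -/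
def IsDistribution {M : GradedSpace.{u}} (K : Submodule M.Fn (M.Fn →ₗ[ℝ] M.Fn)) : Prop :=
  ∃ s : Set (M.Fn →ₗ[ℝ] M.Fn), s.Finite ∧
    (∀ V ∈ s, ∃ (k : ℤ) (W : VectorField M k), V = W.toFun) ∧ K = Submodule.span M.Fn s

variable (n : ℕ) (X : Type u) [TopologicalSpace X] [ChartedSpace (EuclideanSpace ℝ (Fin n)) X]

/-- A weak gauge PDE `(B, γ, K_B, T[1]X)`.  Of the bundle `B → T[1]X` only the injectivity of the
pullback of functions is recorded. -/
structure WeakGaugePDE where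
  B : GradedSpace.{w}
  proj : Hom B (T1X n X)
  proj_injective : Function.Injective proj.pull
  γ : VectorField B 1
  γ_proj : ProjectsTo proj γ (dX n X)
  K : Submodule B.Fn (B.Fn →ₗ[ℝ] B.Fn)
  isDistribution : IsDistribution K
  vertical : ∀ V ∈ K, ∀ f : (T1X n X).Fn, V (proj.pull f) = 0
  involutive : ∀ {k l : ℤ} (V : VectorField B k) (W : VectorField B l),
    V.toFun ∈ K → W.toFun ∈ K → (bracket V W).toFun ∈ K
  γ_K : ∀ {k : ℤ} (V : VectorField B k), V.toFun ∈ K → (bracket γ V).toFun ∈ K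
  γ_sq : γ.toFun ∘ₗ γ.toFun ∈ K

/-- The ideal `I_B` of the forms on `E` generated by the pullbacks of the `1`-forms on `B`
annihilated by the distribution `K`.  (A left ideal; by graded commutativity it is two-sided.) -/
def backgroundIdeal {E : GradedSpace.{v}} {B : GradedSpace.{w}} (φ : Hom E B)
    (K : Submodule B.Fn (B.Fn →ₗ[ℝ] B.Fn)) : Ideal E.T1.Fn :=
  Ideal.span {x | ∃ α ∈ B.formsOfDegree 1,
    (∀ (k : ℤ) (V : VectorField B k), V.toFun ∈ K → contract V α = 0) ∧ x = pullForm φ α}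

/-- A presymplectic gauge PDE over background `(E, Q, ω) → (B, γ, K_B, T[1]X)`; the presymplectic
form `ω` is the field `symp`. -/
structure PresymplecticGaugePDE extends WeakGaugePDE.{u, w} n X where
  E : GradedSpace.{v}
  projB : Hom E B
  projB_injective : Function.Injective projB.pull
  Q : VectorField E 1
  Q_proj : ProjectsTo projB Q γ
  symp : E.T1.Fn
  symp_mem : symp ∈ E.forms 2 (n - 1)
  symp_closed : E.d symp = 0
  L : E.Fn
  L_deg : L ∈ E.deg n
  hamiltonian : contract Q symp + E.d (E.fn L) ∈ backgroundIdeal projB K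
  master : (1 / 2 : ℝ) • contract Q (contract Q symp) + E.fn (Q.toFun L) = 0
  exists_lift : ∀ {k : ℤ} (v : VectorField B k), v.toFun ∈ K →
    ∃ V : VectorField E k, ProjectsTo projB V v ∧ contract V symp ∈ backgroundIdeal projB K

namespace PresymplecticGaugePDE

variable {n X} (P : PresymplecticGaugePDE.{u, v, w} n X)

/-- The ideal `I_B` of forms on `E`. -/
def idealB : Ideal P.E.T1.Fn := backgroundIdeal P.projB P.K

/-- The projection `E → B → T[1]X`. -/
def projX : Hom P.E (T1X n X) := P.proj.comp P.projB

/-- The distribution `K` on `E` generated by the projectable vector fields `V` with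
`i_V ω ∈ I_B` and `(π_B)_* V ∈ K_B`. -/
def distribution : Submodule P.E.Fn (P.E.Fn →ₗ[ℝ] P.E.Fn) :=
  Submodule.span P.E.Fn {F | ∃ (k : ℤ) (V : VectorField P.E k) (v : VectorField P.B k),
    F = V.toFun ∧ ProjectsTo P.projB V v ∧ v.toFun ∈ P.K ∧ contract V P.symp ∈ P.idealB}

/-- A vector field preserves the distribution `K`. -/
def PreservesDistribution {k : ℤ} (Y : VectorField P.E k) : Prop :=
  ∀ {l : ℤ} (V : VectorField P.E l), V.toFun ∈ P.distribution →
    (bracket Y V).toFun ∈ P.distribution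

/-- Sections `σ : T[1]X → E`. -/
structure Sec where
  map : Hom (T1X n X) P.E
  isSection : ∀ f : (T1X n X).Fn, map.pull (P.projX.pull f) = f

variable {P}

namespace Sec

variable (σ : P.Sec)

/-- The projection of the section to `B` is a solution of the background weak gauge PDE:
`d_X ∘ σ_B^* = σ_B^* ∘ γ + σ_B^* ∘ k` for some `k ∈ K_B`, where `σ_B = π_B ∘ σ`. -/
def SolvesBackground : Prop :=
  ∃ κ : VectorField P.B 1, κ.toFun ∈ P.K ∧ ∀ f : P.B.Fn,
    (dX n X).toFun (σ.map.pull (P.projB.pull f)) =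
      σ.map.pull (P.projB.pull (P.γ.toFun f)) + σ.map.pull (P.projB.pull (κ.toFun f))

/-- `σ^*(α)(d_X)`: the form `i_{d_X} σ^* α` on `T[1]X`. -/
def evalDX (α : P.E.T1.Fn) : (T1X n X).T1.Fn := contract (dX n X) (pullForm σ.map α)

/-- The integrand `σ^*(χ)(d_X) + σ^* L` of the AKSZ-like action, a function on `T[1]X`. -/
def integrand (χ : P.E.T1.Fn) : (T1X n X).Fn :=
  (T1X n X).scalar (σ.evalDX χ) + σ.map.pull P.L

/-- The first variation of the integrand of the AKSZ-like action when `σ^*` is changed to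
`σ^* + ε δ`, `ε² = 0`. -/
def integrandVariation (χ : P.E.T1.Fn) (δ : VectorAlong σ.map 0) : (T1X n X).Fn :=
  (T1X n X).scalar (contract (dX n X) ((formVariation δ).toFun χ)) + δ.toFun P.L

/-- The gauge transformation `δ σ^* = σ^* ∘ [Q, Y] - [d_X, y] ∘ σ^*`, a vector field of degree `0`
along `σ`. -/
def gaugeVariation (Y : VectorField P.E (-1)) (y : VectorField (T1X n X) (-1)) :
    VectorAlong σ.map 0 where
  toFun := σ.map.pull.toLinearMap ∘ₗ (bracket P.Q Y).toFun -
    (bracket (dX n X) y).toFun ∘ₗ σ.map.pull.toLinearMap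
  map_deg {i a} ha := by
    refine Submodule.sub_mem _ ?_ ?_
    · exact σ.map.map_deg ((bracket P.Q Y).map_deg ha)
    · exact (bracket (dX n X) y).map_deg (σ.map.map_deg ha)
  leibniz {i a} ha b := by
    change σ.map.pull ((bracket P.Q Y).toFun (a * b)) -
        (bracket (dX n X) y).toFun (σ.map.pull (a * b)) =
      (σ.map.pull ((bracket P.Q Y).toFun a) - (bracket (dX n X) y).toFun (σ.map.pull a)) *
        σ.map.pull b + sgn (0 * i) • (σ.map.pull a *
        (σ.map.pull ((bracket P.Q Y).toFun b) - (bracket (dX n X) y).toFun (σ.map.pull b)))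
    have h1 : σ.map.pull (a * b) = σ.map.pull a * σ.map.pull b := map_mul _ _ _
    rw [h1, (bracket P.Q Y).leibniz_field ha,
      (bracket (dX n X) y).leibniz_field (σ.map.map_deg ha)]
    have : sgn ((1 + -1) * i) = 1 := by simp
    rw [this, zero_mul, sgn_zero, one_smul, one_smul, one_smul, map_add, map_mul, map_mul,
      sub_mul, mul_sub]
    abel

/-- `i_{E_σ} α = σ^*(α)(d_X) - σ^*(i_Q α)` on `1`-forms, with `E_σ = d_X ∘ σ^* - σ^* ∘ Q`. -/
def contractE (α : P.E.T1.Fn) : (T1X n X).T1.Fn :=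
  σ.evalDX α - pullForm σ.map (contract P.Q α)

/-- `i²_{E_σ} Ω` on `2`-forms, normalised by
`½ i²_{E_σ} Ω = σ^*(Ω)(d_X, d_X) - 2 σ^*(i_Q Ω)(d_X) + σ^*(i_Q i_Q Ω)`. -/
def contractE2 (Ω : P.E.T1.Fn) : (T1X n X).T1.Fn :=
  (2 : ℝ) • (contract (dX n X) (σ.evalDX Ω) - (2 : ℝ) • σ.evalDX (contract P.Q Ω) +
    pullForm σ.map (contract P.Q (contract P.Q Ω)))

/-- The integrand
`σ^*(L_Y(½ i_Q i_Q ω + Q L)) + i_{E_σ} L_Y(i_Q ω + d L) + ¼ i²_{E_σ} L_Y ω`. -/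
def threeTerm (Y : VectorField P.E (-1)) : (T1X n X).Fn :=
  (T1X n X).scalar
    (pullForm σ.map
        (lie Y ((1 / 2 : ℝ) • contract P.Q (contract P.Q P.symp) + P.E.fn (P.Q.toFun P.L))) +
      σ.contractE (lie Y (contract P.Q P.symp + P.E.d (P.E.fn P.L))) +
      (1 / 4 : ℝ) • σ.contractE2 (lie Y P.symp))

/-- The local current
`j = σ^*(i_{[Q,Y]} χ + Y L) + σ^*(L_Y χ)(d_X) - y (σ^*(χ)(d_X) + σ^* L)`
whose `d_X` is the total derivative in the variation of the integrand. -/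
def current (χ : P.E.T1.Fn) (Y : VectorField P.E (-1)) (y : VectorField (T1X n X) (-1)) :
    (T1X n X).Fn :=
  σ.map.pull (P.E.scalar (contract (bracket P.Q Y) χ) + Y.toFun P.L) +
    (T1X n X).scalar (σ.evalDX (lie Y χ)) - y.toFun (σ.integrand χ)

end Sec

end PresymplecticGaugePDE

end GaugePDE

end
end GradedGeometry

/-!
The first variation formula is a computation in the Cartan calculus of the algebras of forms. All
operators involved (`i_V`, `L_V`, `d`, pullbacks and their variations) are derivations along maps,
so an identity between them need only be checked on functions and on their differentials
(`IsDerivation.ext_forms`). This gives `[L_V, i_W] = i_{[V, W]}`, the graded commutativity of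
contractions, and `δ = σ^* L_{[Q, Y]} - L_{[d_X, y]} σ^*` for the variation of the pullback of forms
(`formVariation_gaugeVariation`).

Write `ω = d χ`. As `[d_X, y]` commutes with `d_X`, the variation of the integrand `ℓ` is
`σ^*(i_{[Q, Y]} ω)(d_X) + σ^*([Q, Y] L)` plus the total derivative of `σ^* i_{[Q, Y]} χ`, minus
`[d_X, y] ℓ`. In the last term `y d_X ℓ` vanishes because `d_X ℓ` is a form of degree `n + 1` on the
`n`-dimensional manifold `X`. On the other side, in the three terms of the formula
(`threeTerm_eq`), the part quadratic in `d_X` is exact because `L_Y ω = -d L_Y χ` and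
`i_{d_X} i_{d_X} d = 2 d_X i_{d_X}` in form degree zero; the part without `d_X` cancels since
`[[L_Y, i_Q], i_Q] = [i_{[Q, Y]}, i_Q] = 0`, and what is left is the expression above up to total
derivatives.

That forms of degree `n + 1` on `X` vanish (`ManifoldForm.eq_zero_of_mem_deg_succ`) has to be proved
for the algebra of forms in use, Kähler forms modulo those vanishing to infinite order at every
point. By iteration of Hadamard's lemma the differential of any function is, modulo forms vanishing
at `p` to any given order, a combination of the differentials of `n` fixed functions; products of
`n + 1` of these vanish, as the `(n + 1)`-st exterior power of `ℝ ^ n` does.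

For the second part, `i_{E_σ}` is a derivation along `σ`, and `i_{E_σ}²` is a second order operator
built from it. When `σ` projects to a solution of the background equations, `i_{E_σ} π_B^* α` is
the pullback of `i_κ α` with `κ` in the distribution `K_B`, so that both operators vanish on the
ideal `I_B` in form degree zero (`scalar_contractE_idealB`). Finally `L_Y` preserves `I_B`
(`lie_mem_idealB`): a one-form on `B` annihilated by `K_B` is annihilated by the projections of the
projectable elements of the distribution on `E`, in particular by those of `[Y, V]`, for lifts `V`
of elements of `K_B`.
-/

namespace GradedGeometry

noncomputable section

open GradedSpace

/-! ### Derivations along maps -/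

/-- A linear map `F` is a derivation of degree `k` along the map `Φ`.  This is the unbundled form of
`VectorAlong`: identities between composites of vector fields need no casts between degrees. -/
structure IsDerivation {S : GradedSpace.{u}} {N : GradedSpace.{v}} (Φ : Hom S N) (k : ℤ)
    (F : N.Fn →ₗ[ℝ] S.Fn) : Prop where
  map_deg : ∀ {i : ℤ} {a : N.Fn}, a ∈ N.deg i → F a ∈ S.deg (i + k)
  leibniz : ∀ {i : ℤ} {a : N.Fn}, a ∈ N.deg i → ∀ b : N.Fn,
    F (a * b) = F a * Φ.pull b + sgn (k * i) • (Φ.pull a * F b)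

theorem VectorAlong.isDerivation {S : GradedSpace.{u}} {N : GradedSpace.{v}} {Φ : Hom S N} {k : ℤ}
    (V : VectorAlong Φ k) : IsDerivation Φ k V.toFun :=
  ⟨V.map_deg, V.leibniz⟩

namespace IsDerivation

variable {S : GradedSpace.{u}} {N : GradedSpace.{v}} {Φ : Hom S N} {k l : ℤ}
  {F G : N.Fn →ₗ[ℝ] S.Fn}

theorem of_eq (h : IsDerivation Φ k F) (hk : k = l) : IsDerivation Φ l F := hk ▸ h

theorem sub (hF : IsDerivation Φ k F) (hG : IsDerivation Φ k G) : IsDerivation Φ k (F - G) where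
  map_deg ha := Submodule.sub_mem _ (hF.map_deg ha) (hG.map_deg ha)
  leibniz ha b := by
    simp only [LinearMap.sub_apply, hF.leibniz ha, hG.leibniz ha, sub_mul, mul_sub, smul_sub]
    abel

theorem smul (hF : IsDerivation Φ k F) (c : ℝ) : IsDerivation Φ k (c • F) where
  map_deg ha := Submodule.smul_mem _ _ (hF.map_deg ha)
  leibniz ha b := by
    simp only [LinearMap.smul_apply, hF.leibniz ha, smul_mul_assoc, mul_smul_comm, smul_add]
    rw [smul_comm c]

theorem zero : IsDerivation Φ k 0 where
  map_deg _ := Submodule.zero_mem _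
  leibniz _ _ := by simp

theorem comp_pull {P : GradedSpace.{w}} (hF : IsDerivation Φ k F) (ψ : Hom N P) :
    IsDerivation (ψ.comp Φ) k (F ∘ₗ ψ.pull.toLinearMap) where
  map_deg ha := hF.map_deg (ψ.map_deg ha)
  leibniz ha b := by
    change F (ψ.pull (_ * b)) = _
    rw [map_mul, hF.leibniz (ψ.map_deg ha)]
    rfl

theorem pull_comp {P : GradedSpace.{w}} (hF : IsDerivation Φ k F) (ψ : Hom P S) :
    IsDerivation (Φ.comp ψ) k (ψ.pull.toLinearMap ∘ₗ F) where
  map_deg ha := ψ.map_deg (hF.map_deg ha)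
  leibniz ha b := by
    change ψ.pull (F (_ * b)) = _
    rw [hF.leibniz ha, map_add, map_smul, map_mul, map_mul]
    rfl

/-- A derivation of an algebra of forms is determined by its values on the functions and on their
differentials. -/
theorem ext_forms {M : GradedSpace.{v}} {Φ : Hom S M.T1} {F G : M.T1.Fn →ₗ[ℝ] S.Fn}
    (hF : IsDerivation Φ k F) (hG : IsDerivation Φ k G)
    (hfn : ∀ {i : ℤ} {a : M.Fn}, a ∈ M.deg i → F (M.fn a) = G (M.fn a))
    (hdfn : ∀ {i : ℤ} {a : M.Fn}, a ∈ M.deg i → F (M.dfn a) = G (M.dfn a)) : F = G := by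
  refine LinearMap.ext fun x => ?_
  induction x using M.T1.hom_induction with
  | h0 => simp
  | hadd x y hx hy => rw [map_add, map_add, hx, hy]
  | hom n x hx =>
    refine T1_deg_induction (M := M) (C := fun _ x => F x = G x) ?_ ?_ ?_ ?_ ?_ ?_ hx
    · have := hfn (a := 1) (SetLike.GradedOne.one_mem (A := M.deg))
      rwa [map_one] at this
    · simp
    · intro _ x y hx hy; rw [map_add, map_add, hx, hy]
    · intro _ r x hx; rw [map_smul, map_smul, hx]
    · intro i n a x ha _ hx
      rw [hF.leibniz (fn_mem ha), hG.leibniz (fn_mem ha), hfn ha, hx]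
    · intro i n a x ha _ hx
      rw [hF.leibniz (dfn_mem ha), hG.leibniz (dfn_mem ha), hdfn ha, hx]

/-- The Leibniz rule for a derivation of even degree needs no homogeneity. -/
theorem leibniz_zero (hF : IsDerivation Φ 0 F) (a b : N.Fn) :
    F (a * b) = F a * Φ.pull b + Φ.pull a * F b := by
  induction a using N.hom_induction with
  | h0 => simp
  | hadd a c ha hc => simp only [add_mul, map_add, ha, hc]; abel
  | hom i a ha => rw [hF.leibniz ha, zero_mul, sgn_zero, one_smul]

/-- The Leibniz rule for inhomogeneous functions. -/
theorem leibniz_parity (hF : IsDerivation Φ k F) (a b : N.Fn) :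
    F (a * b) = F a * Φ.pull b + Φ.pull (N.parity k a) * F b := by
  induction a using N.hom_induction with
  | h0 => simp
  | hadd a c ha hc => simp only [add_mul, map_add, ha, hc]; abel
  | hom i a ha => rw [hF.leibniz ha, N.parity_apply k ha, map_smul, smul_mul_assoc]

end IsDerivation

namespace GradedSpace

/-! ### Identities of the Cartan calculus -/

variable {M : GradedSpace.{u}} {k l : ℤ}

/-- The Lie derivative as a linear map. -/
def lieLin (V : VectorField M k) : M.T1.Fn →ₗ[ℝ] M.T1.Fn :=
  (contraction V).toFun ∘ₗ M.deRham.toFun + sgn k • (M.deRham.toFun ∘ₗ (contraction V).toFun)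

theorem lieLin_apply (V : VectorField M k) (x : M.T1.Fn) : lieLin V x = lie V x := rfl

theorem lie_isDerivation (V : VectorField M k) : IsDerivation (Hom.id M.T1) k (lieLin V) := by
  have h := (bracket (contraction V) M.deRham).isDerivation.of_eq (l := k) (by ring)
  convert h using 1
  refine LinearMap.ext fun x => ?_
  change contract V (M.d x) + sgn k • M.d (contract V x) =
    contract V (M.d x) - sgn ((k - 1) * 1) • M.d (contract V x)
  have e : sgn ((k - 1) * 1) = -sgn k := by
    rw [mul_one, sub_eq_add_neg, sgn_add, sgn_neg, sgn_one, mul_neg_one]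
  rw [e, neg_smul, sub_neg_eq_add]

theorem contract_isDerivation (V : VectorField M k) :
    IsDerivation (Hom.id M.T1) (k - 1) (contraction V).toFun :=
  (contraction V).isDerivation

theorem contraction_apply (V : VectorField M k) (x : M.T1.Fn) :
    (contraction V).toFun x = contract V x := rfl

theorem deRham_comp_deRham : M.deRham.toFun ∘ₗ M.deRham.toFun = 0 := by
  have h : IsDerivation (Hom.id M.T1) (1 + 1)
      ((1 / 2 : ℝ) • (bracket M.deRham M.deRham).toFun) := (bracket _ _).isDerivation.smul _
  have e : (1 / 2 : ℝ) • (bracket M.deRham M.deRham).toFun = M.deRham.toFun ∘ₗ M.deRham.toFun := by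
    refine LinearMap.ext fun x => ?_
    change (1 / 2 : ℝ) • (M.d (M.d x) - sgn (1 * 1) • M.d (M.d x)) = M.d (M.d x)
    rw [one_mul, sgn_one, neg_smul, one_smul, sub_neg_eq_add, ← two_smul ℝ, smul_smul]
    norm_num
  rw [e] at h
  refine h.ext_forms IsDerivation.zero (fun _ => ?_) (fun _ => ?_)
  · change M.d (M.d (M.fn _)) = 0
    rw [d_fn, d_dfn]
  · change M.d (M.d (M.dfn _)) = 0
    rw [d_dfn]
    exact map_zero _

theorem d_d (x : M.T1.Fn) : M.d (M.d x) = 0 := LinearMap.congr_fun deRham_comp_deRham x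

theorem d_add (x y : M.T1.Fn) : M.d (x + y) = M.d x + M.d y := map_add M.deRham.toFun x y

theorem d_smul (c : ℝ) (x : M.T1.Fn) : M.d (c • x) = c • M.d x := map_smul M.deRham.toFun c x

theorem d_zero : M.d (0 : M.T1.Fn) = 0 := map_zero M.deRham.toFun

theorem contract_add (V : VectorField M k) (x y : M.T1.Fn) :
    contract V (x + y) = contract V x + contract V y := map_add (contraction V).toFun x y

theorem contract_smul (V : VectorField M k) (c : ℝ) (x : M.T1.Fn) :
    contract V (c • x) = c • contract V x := map_smul (contraction V).toFun c x

theorem contract_zero (V : VectorField M k) : contract V 0 = 0 := map_zero (contraction V).toFun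

theorem contract_neg (V : VectorField M k) (x : M.T1.Fn) : contract V (-x) = -contract V x :=
  map_neg (contraction V).toFun x

theorem lie_add (V : VectorField M k) (x y : M.T1.Fn) : lie V (x + y) = lie V x + lie V y :=
  map_add (lieLin V) x y

theorem lie_smul (V : VectorField M k) (c : ℝ) (x : M.T1.Fn) : lie V (c • x) = c • lie V x :=
  map_smul (lieLin V) c x

theorem lie_zero (V : VectorField M k) : lie V 0 = 0 := map_zero (lieLin V)

theorem lie_fn (V : VectorField M k) (a : M.Fn) : lie V (M.fn a) = M.fn (V.toFun a) := by
  rw [lie, d_fn, contract_dfn, contract_fn, d_zero, smul_zero, add_zero]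

theorem lie_dfn (V : VectorField M k) (a : M.Fn) :
    lie V (M.dfn a) = sgn k • M.dfn (V.toFun a) := by
  rw [lie, d_dfn, contract_zero, zero_add, contract_dfn, d_fn]

theorem lie_d (V : VectorField M k) (x : M.T1.Fn) : lie V (M.d x) = sgn k • M.d (lie V x) := by
  rw [lie, lie, d_d, contract_zero, zero_add, d_add, d_smul, d_d, smul_zero, add_zero]

/-- `[L_V, i_W] = i_{[V, W]}`. -/
theorem lie_contract (V : VectorField M k) (W : VectorField M l) (x : M.T1.Fn) :
    lie V (contract W x) =
      sgn (k * (l - 1)) • contract W (lie V x) + contract (bracket V W) x := by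
  have h1 : IsDerivation (Hom.id M.T1) (k + l - 1)
      (lieLin V ∘ₗ (contraction W).toFun -
        sgn (k * (l - 1)) • ((contraction W).toFun ∘ₗ lieLin V)) :=
    (bracket (⟨lieLin V, (lie_isDerivation V).map_deg, (lie_isDerivation V).leibniz⟩ :
      VectorField M.T1 k) (contraction W)).isDerivation.of_eq (by ring)
  have h2 := h1.ext_forms (contract_isDerivation (bracket V W))
    (fun {i a} _ => by
      change lie V (contract W (M.fn a)) - sgn (k * (l - 1)) • contract W (lie V (M.fn a)) =
        contract (bracket V W) (M.fn a)
      rw [contract_fn, lie_fn, contract_fn, contract_fn, lie_zero, smul_zero, sub_zero])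
    (fun {i a} _ => by
      change lie V (contract W (M.dfn a)) - sgn (k * (l - 1)) • contract W (lie V (M.dfn a)) =
        contract (bracket V W) (M.dfn a)
      rw [contract_dfn, lie_dfn, contract_smul, contract_dfn, contract_dfn, lie_fn, smul_smul,
        ← sgn_add, show k * (l - 1) + k = k * l by ring, ← map_smul, ← map_sub]
      rfl)
  have h3 := LinearMap.congr_fun h2 x
  exact sub_eq_iff_eq_add'.mp h3

/-- Contractions graded-commute. -/
theorem contract_contract (V : VectorField M k) (W : VectorField M l) (x : M.T1.Fn) :
    contract V (contract W x) = sgn ((k - 1) * (l - 1)) • contract W (contract V x) := by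
  have h := ((bracket (contraction V) (contraction W)).isDerivation).ext_forms IsDerivation.zero
    (fun {i a} _ => by
      change contract V (contract W (M.fn a)) -
        sgn ((k - 1) * (l - 1)) • contract W (contract V (M.fn a)) = 0
      simp only [contract_fn, contract_zero, smul_zero, sub_zero])
    (fun {i a} _ => by
      change contract V (contract W (M.dfn a)) -
        sgn ((k - 1) * (l - 1)) • contract W (contract V (M.dfn a)) = 0
      simp only [contract_fn, contract_dfn, smul_zero, sub_zero])
  exact sub_eq_zero.mp (LinearMap.congr_fun h x)

/-- The restriction of forms to their components of form degree zero, as a map `M → T[1]M`. -/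
def zeroSection (M : GradedSpace.{u}) : Hom M M.T1 where
  pull := M.scalar
  map_deg h := Form.scalar_deg M h
  map_points p hp := ⟨p, hp, rfl⟩

theorem scalar_lie (V : VectorField M k) (x : M.T1.Fn) :
    M.scalar (lie V x) = V.toFun (M.scalar x) := by
  have h := ((lie_isDerivation V).pull_comp (zeroSection M)).ext_forms
    (V.isDerivation.comp_pull (zeroSection M))
    (fun {i a} _ => by
      change M.scalar (lie V (M.fn a)) = V.toFun (M.scalar (M.fn a))
      rw [lie_fn, scalar_fn, scalar_fn])
    (fun {i a} _ => by
      change M.scalar (lie V (M.dfn a)) = V.toFun (M.scalar (M.dfn a))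
      rw [lie_dfn, map_smul, scalar_dfn, scalar_dfn, map_zero, smul_zero])
  exact LinearMap.congr_fun h x

theorem scalar_d (x : M.T1.Fn) : M.scalar (M.d x) = 0 := by
  have h := ((M.deRham.isDerivation).pull_comp (zeroSection M)).ext_forms IsDerivation.zero
    (fun {i a} _ => by
      change M.scalar (M.d (M.fn a)) = 0
      rw [d_fn, scalar_dfn])
    (fun {i a} _ => by
      change M.scalar (M.d (M.dfn a)) = 0
      rw [d_dfn, map_zero])
  exact LinearMap.congr_fun h x

/-- In form degree zero Cartan's formula reads `i_V d x = V x`. -/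
theorem scalar_contract_d (V : VectorField M k) (x : M.T1.Fn) :
    M.scalar (contract V (M.d x)) = V.toFun (M.scalar x) := by
  have h := scalar_lie V x
  rwa [lie, map_add, map_smul, scalar_d, smul_zero, add_zero] at h

variable {N : GradedSpace.{v}}

theorem pullForm_add (φ : Hom M N) (x y : N.T1.Fn) :
    pullForm φ (x + y) = pullForm φ x + pullForm φ y := map_add (T1.map φ).pull x y

theorem pullForm_smul (φ : Hom M N) (c : ℝ) (x : N.T1.Fn) :
    pullForm φ (c • x) = c • pullForm φ x := map_smul (T1.map φ).pull c x

theorem pullForm_mul (φ : Hom M N) (x y : N.T1.Fn) :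
    pullForm φ (x * y) = pullForm φ x * pullForm φ y := map_mul (T1.map φ).pull x y

theorem pullForm_zero (φ : Hom M N) : pullForm φ (0 : N.T1.Fn) = 0 := map_zero (T1.map φ).pull

theorem pullForm_fn (φ : Hom M N) (a : N.Fn) : pullForm φ (N.fn a) = M.fn (φ.pull a) :=
  T1.map_fn φ a

theorem pullForm_dfn (φ : Hom M N) (a : N.Fn) : pullForm φ (N.dfn a) = M.dfn (φ.pull a) :=
  T1.map_dfn φ a

/-- Two multiplicative linear maps out of an algebra of forms agree if they agree on generators. -/
theorem algHom_ext_forms {T : Type*} [Ring T] [Algebra ℝ T] {F G : M.T1.Fn →ₐ[ℝ] T}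
    (hfn : ∀ a, F (M.fn a) = G (M.fn a)) (hdfn : ∀ a, F (M.dfn a) = G (M.dfn a)) : F = G := by
  refine AlgHom.ext fun x => ?_
  induction x using Form.induction (M := M) with
  | hfn a => exact hfn a
  | hdd a => exact hdfn a
  | hmul x y hx hy =>
    exact (map_mul F x y).trans ((congrArg₂ (· * ·) hx hy).trans (map_mul G x y).symm)
  | hadd x y hx hy =>
    exact (map_add F x y).trans ((congrArg₂ (· + ·) hx hy).trans (map_add G x y).symm)

theorem scalar_pullForm (φ : Hom M N) (x : N.T1.Fn) :
    M.scalar (pullForm φ x) = φ.pull (N.scalar x) := by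
  have h : M.scalar.comp (T1.map φ).pull = φ.pull.comp N.scalar := by
    refine algHom_ext_forms (fun a => ?_) (fun a => ?_)
    · change M.scalar ((T1.map φ).pull (N.fn a)) = φ.pull (N.scalar (N.fn a))
      rw [T1.map_fn, scalar_fn, scalar_fn]
    · change M.scalar ((T1.map φ).pull (N.dfn a)) = φ.pull (N.scalar (N.dfn a))
      rw [T1.map_dfn, scalar_dfn, scalar_dfn, map_zero]
  exact DFunLike.congr_fun h x

theorem pullForm_d (φ : Hom M N) (x : N.T1.Fn) : pullForm φ (N.d x) = M.d (pullForm φ x) := by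
  have h := (N.deRham.isDerivation.pull_comp (T1.map φ)).ext_forms
    (M.deRham.isDerivation.comp_pull (T1.map φ))
    (fun {i a} _ => by
      change pullForm φ (N.d (N.fn a)) = M.d (pullForm φ (N.fn a))
      rw [d_fn, pullForm_fn, pullForm_dfn, d_fn])
    (fun {i a} _ => by
      change pullForm φ (N.d (N.dfn a)) = M.d (pullForm φ (N.dfn a))
      rw [d_dfn, pullForm_dfn, d_dfn, pullForm_zero])
  exact LinearMap.congr_fun h x

end GradedSpace

/-! ### Hadamard's lemma -/

open MeasureTheory in
/-- The integral of a smooth function over a segment of parameters is smooth.  It is a convolution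
with the indicator function of the unit interval, after a cutoff in the integration variable. -/
theorem contDiff_integral_Icc {E F : Type*} [NormedAddCommGroup E] [NormedSpace ℝ E]
    [NormedAddCommGroup F] [NormedSpace ℝ F] {H : E × ℝ → F} (hH : ContDiff ℝ ∞ H) :
    ContDiff ℝ ∞ fun u => ∫ t in Set.Icc (0 : ℝ) 1, H (u, t) := by
  -- The cutoff is equal to `1` on `[-1, 1]`; the convolution evaluates it at `-t`.
  let θ : ContDiffBump (0 : ℝ) := ⟨1, 2, one_pos, one_lt_two⟩
  have hθ : ∀ t ∈ Set.Icc (0 : ℝ) 1, θ (-t) = 1 := by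
    intro t ht
    refine θ.one_of_mem_closedBall ?_
    rw [mem_closedBall_zero_iff, norm_neg, Real.norm_of_nonneg ht.1]
    exact ht.2
  have h := contDiffOn_convolution_right_with_param_comp (μ := volume) (n := ⊤)
    (ContinuousLinearMap.lsmul ℝ ℝ : ℝ →L[ℝ] F →L[ℝ] F) (s := (Set.univ : Set E))
    (v := fun _ => (0 : ℝ)) contDiffOn_const
    (f := Set.indicator (Set.Icc (0 : ℝ) 1) fun _ => (1 : ℝ))
    (g := fun u s => θ s • H (u, -s)) (k := Metric.closedBall 0 2) isOpen_univ
    (isCompact_closedBall _ _)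
    (by
      intro u s _ hs
      rw [θ.zero_of_le_dist (by rw [Metric.mem_closedBall, not_le] at hs; exact hs.le), zero_smul])
    (((integrable_indicator_iff measurableSet_Icc).mpr (by simp)).locallyIntegrable)
    (by
      refine ContDiff.contDiffOn ?_
      change ContDiff ℝ ∞ fun q : E × ℝ => θ q.2 • H (q.1, -q.2)
      exact (θ.contDiff.comp contDiff_snd).smul (hH.comp (contDiff_fst.prodMk contDiff_snd.neg)))
  rw [contDiffOn_univ] at h
  convert h using 2 with u
  rw [convolution_def, ← integral_indicator measurableSet_Icc]
  refine integral_congr_ae (Filter.Eventually.of_forall fun t => ?_)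
  by_cases ht : t ∈ Set.Icc (0 : ℝ) 1
  · simp [Set.indicator_of_mem ht, hθ t ht]
  · simp [Set.indicator_of_notMem ht]

/-- Hadamard's lemma in a normed space. -/
theorem exists_contDiff_hadamard {E : Type*} [NormedAddCommGroup E] [NormedSpace ℝ E]
    {F : E → ℝ} (hF : ContDiff ℝ ∞ F) (u₀ : E) :
    ∃ G : E → E →L[ℝ] ℝ, ContDiff ℝ ∞ G ∧ ∀ u, F u - F u₀ = G u (u - u₀) := by
  have hline : ContDiff ℝ ∞ fun q : E × ℝ => u₀ + q.2 • (q.1 - u₀) :=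
    contDiff_const.add (contDiff_snd.smul (contDiff_fst.sub contDiff_const))
  have hdF : ContDiff ℝ ∞ (fderiv ℝ F) := hF.fderiv_right (by simp)
  have hH : ContDiff ℝ ∞ fun q : E × ℝ => fderiv ℝ F (u₀ + q.2 • (q.1 - u₀)) := hdF.comp hline
  refine ⟨_, contDiff_integral_Icc hH, fun u => ?_⟩
  have hcont : Continuous fun t : ℝ => fderiv ℝ F (u₀ + t • (u - u₀)) :=
    hH.continuous.comp (continuous_const.prodMk continuous_id)
  have hderiv : ∀ t : ℝ, HasDerivAt (fun t : ℝ => F (u₀ + t • (u - u₀)))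
      (fderiv ℝ F (u₀ + t • (u - u₀)) (u - u₀)) t := by
    intro t
    have h1 : HasDerivAt (fun t : ℝ => u₀ + t • (u - u₀)) (u - u₀) t := by
      simpa using ((hasDerivAt_id t).smul_const (u - u₀)).const_add u₀
    exact ((hF.differentiable (by simp)) _).hasFDerivAt.comp_hasDerivAt t h1
  have hint : IntervalIntegrable (fun t : ℝ => fderiv ℝ F (u₀ + t • (u - u₀)) (u - u₀))
      MeasureTheory.volume 0 1 := (hcont.clm_apply continuous_const).intervalIntegrable _ _
  have h2 := intervalIntegral.integral_eq_sub_of_hasDerivAt (fun t _ => hderiv t) hint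
  rw [one_smul, add_sub_cancel, zero_smul, add_zero] at h2
  rw [← h2, MeasureTheory.integral_Icc_eq_integral_Ioc,
    ← intervalIntegral.integral_of_le zero_le_one,
    ContinuousLinearMap.intervalIntegral_apply (hcont.intervalIntegrable _ _)]

/-- Hadamard's lemma on a manifold: cut off coordinates at `p` generate the functions vanishing at
`p`, up to functions vanishing near `p`. -/
theorem exists_contMDiff_hadamard {n : ℕ} {X : Type u} [TopologicalSpace X]
    [ChartedSpace (EuclideanSpace ℝ (Fin n)) X] [T2Space X] [IsManifold (𝓡 n) ∞ X] (p : X) :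
    ∃ x : Fin n → C^∞⟮𝓡 n, X; ℝ⟯, (∀ i, x i p = 0) ∧ ∀ f : C^∞⟮𝓡 n, X; ℝ⟯,
      ∃ g : Fin n → C^∞⟮𝓡 n, X; ℝ⟯, ∀ᶠ q in nhds p, f q - f p = ∑ i, x i q * g i q := by
  obtain ⟨ρ⟩ : Nonempty (SmoothBumpFunction (𝓡 n) p) := inferInstance
  set φ := extChartAt (𝓡 n) p with hφ
  have hφs : ContMDiffOn (𝓡 n) 𝓘(ℝ, EuclideanSpace ℝ (Fin n)) ∞ φ
      (chartAt (EuclideanSpace ℝ (Fin n)) p).source := contMDiffOn_extChartAt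
  have hcut : ∀ u : EuclideanSpace ℝ (Fin n) → ℝ, ContDiff ℝ ∞ u →
      ContMDiff (𝓡 n) 𝓘(ℝ, ℝ) ∞ fun q => ρ q • u (φ q) := fun u hu =>
    ρ.contMDiff_smul (hu.contMDiff.comp_contMDiffOn hφs)
  have hcoord : ∀ i : Fin n, ContDiff ℝ ∞ fun u : EuclideanSpace ℝ (Fin n) => u i - φ p i :=
    fun i => (EuclideanSpace.proj (𝕜 := ℝ) i).contDiff.sub contDiff_const
  refine ⟨fun i => ⟨_, hcut _ (hcoord i)⟩, fun i => ?_, fun f => ?_⟩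
  · change ρ p • (φ p i - φ p i) = 0
    rw [sub_self, smul_zero]
  -- Hadamard's lemma in the model space applies to `f` in the chart at `p`, cut off by `ψ` so as to
  -- be smooth on the whole model space.
  have htarget : φ.target ∈ nhds (φ p) := extChartAt_target_mem_nhds p
  obtain ⟨r, hr, hrt⟩ := Metric.nhds_basis_closedBall.mem_iff.mp htarget
  let ψ : ContDiffBump (φ p) := ⟨r / 2, r, half_pos hr, half_lt_self hr⟩
  have hfs : ContDiffOn ℝ ∞ (fun u => f (φ.symm u)) φ.target :=
    (f.contMDiff.comp_contMDiffOn (contMDiffOn_extChartAt_symm p)).contDiffOn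
  have hF : ContDiff ℝ ∞ fun u => ψ u * f (φ.symm u) := by
    rw [contDiff_iff_contDiffAt]
    intro u
    by_cases hu : u ∈ φ.target
    · exact ψ.contDiff.contDiffAt.mul
        (hfs.contDiffAt ((isOpen_extChartAt_target p).mem_nhds hu))
    · have hu' : u ∉ tsupport ψ := fun h => hu (hrt (by rwa [ψ.tsupport_eq] at h))
      have h0 : (fun u => ψ u * f (φ.symm u)) =ᶠ[nhds u] fun _ => 0 := by
        filter_upwards [notMem_tsupport_iff_eventuallyEq.mp hu'] with v hv
        rw [hv, Pi.zero_apply, zero_mul]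
      exact contDiffAt_const.congr_of_eventuallyEq h0
  obtain ⟨G, hG, hGe⟩ := exists_contDiff_hadamard hF (φ p)
  let b := EuclideanSpace.basisFun (Fin n) ℝ
  refine ⟨fun i => ⟨_, hcut (fun u => G u (b i)) (hG.clm_apply contDiff_const)⟩, ?_⟩
  have hcont : ContinuousAt φ p := continuousAt_extChartAt p
  filter_upwards [ρ.eventuallyEq_one, extChartAt_source_mem_nhds (I := 𝓡 n) p,
    hcont.eventually ψ.eventuallyEq_one] with q hq1 hq2 hq3
  have h1 := hGe (φ q)
  have h3 : ψ (φ p) = 1 := ψ.one_of_mem_closedBall (Metric.mem_closedBall_self (half_pos hr).le)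
  have h4 : ψ (φ q) = 1 := hq3
  have h5 : ρ q = 1 := hq1
  rw [h3, h4, one_mul, one_mul, φ.left_inv hq2, φ.left_inv (mem_extChartAt_source p)] at h1
  rw [h1]
  change _ = ∑ i, (ρ q • (φ q i - φ p i)) * (ρ q • G (φ q) (b i))
  have h6 := b.sum_repr (φ q - φ p)
  conv_lhs => rw [← h6]
  rw [map_sum]
  refine Finset.sum_congr rfl fun i _ => ?_
  rw [map_smul, h5, one_smul, one_smul, smul_eq_mul]
  rfl

/-! ### Forms on a manifold above the top degree -/

namespace ManifoldForm

variable {n : ℕ} {X : Type u} [TopologicalSpace X] [ChartedSpace (EuclideanSpace ℝ (Fin n)) X]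

theorem mem_deg_zero (a : (ofManifold n X).Fn) : a ∈ (ofManifold n X).deg 0 := by
  change a ∈ trivialDeg _ 0
  simp [trivialDeg]

theorem dFn_mul (a b : (ofManifold n X).Fn) :
    Form.dFn _ (a * b) = Form.dFn _ a * Form.ofFn _ b + Form.ofFn _ a * Form.dFn _ b := by
  rw [Form.dFn_mul b (mem_deg_zero a), sgn_zero, one_smul]

theorem dFn_one : Form.dFn (ofManifold n X) 1 = 0 := by
  have h := dFn_mul (1 : (ofManifold n X).Fn) 1
  rwa [mul_one, map_one (Form.ofFn (ofManifold n X)), mul_one, one_mul, left_eq_add] at h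

theorem dFn_mul_self (a : (ofManifold n X).Fn) : Form.dFn _ a * Form.dFn _ a = 0 := by
  have h := Form.dFn_dFn (mem_deg_zero a) (mem_deg_zero a)
  rw [zero_add, one_mul, sgn_one, neg_smul, one_smul, eq_neg_iff_add_eq_zero, ← two_smul ℝ] at h
  exact (smul_eq_zero.mp h).resolve_left two_ne_zero

/-- Functions are central in the algebra of forms on a manifold. -/
theorem ofFn_comm (a : (ofManifold n X).Fn) (x : (ofManifold n X).Form) :
    x * Form.ofFn _ a = Form.ofFn _ a * x := by
  induction x using Form.induction with
  | hfn b => rw [Form.ofFn_ofFn (mem_deg_zero b) (mem_deg_zero a), zero_mul, sgn_zero, one_smul]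
  | hdd b =>
    rw [Form.ofFn_dFn (mem_deg_zero a) (mem_deg_zero b), zero_mul, sgn_zero, one_smul]
  | hmul x y hx hy => rw [mul_assoc, hy, ← mul_assoc, hx, mul_assoc]
  | hadd x y hx hy => rw [add_mul, hx, hy, mul_add]

variable (n) in
/-- Evaluation at a point, on the functions of the graded space of a manifold. -/
def evalFn (p : X) : (ofManifold n X).Fn →ₐ[ℝ] ℝ := evalAt n X p

variable (n) in
/-- The ideal of the forms on `X` whose component of form degree zero vanishes at `p`. -/
abbrev ideal (p : X) : Submodule ℝ (ofManifold n X).Form :=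
  maxIdeal ((evalFn n p).comp (Form.scalar (ofManifold n X)))

theorem ofFn_mem_ideal {p : X} {f : (ofManifold n X).Fn} (hf : evalFn n p f = 0) :
    Form.ofFn (ofManifold n X) f ∈ ideal n p := by
  rw [mem_maxIdeal, AlgHom.comp_apply, Form.scalar_ofFn]
  exact hf

theorem dFn_mem_ideal (p : X) (f : (ofManifold n X).Fn) :
    Form.dFn (ofManifold n X) f ∈ ideal n p := by
  rw [mem_maxIdeal, AlgHom.comp_apply, Form.scalar_dFn, map_zero]

theorem exists_mul_eq_self_of_eventually_zero [T2Space X] [IsManifold (𝓡 n) ∞ X] {p : X}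
    {h : (ofManifold n X).Fn} (hh : ∀ᶠ q in nhds p, evalFn n q h = 0) :
    ∃ e : (ofManifold n X).Fn, evalFn n p e = 0 ∧ h * e = h := by
  obtain ⟨ρ, -, hρ⟩ := (SmoothBumpFunction.nhds_basis_support (I := 𝓡 n) hh).mem_iff.mp hh
  let r : C^∞⟮𝓡 n, X; ℝ⟯ := ⟨ρ, ρ.contMDiff⟩
  refine ⟨(1 - r : C^∞⟮𝓡 n, X; ℝ⟯), ?_, ContMDiffMap.ext fun q => ?_⟩
  · change 1 - ρ p = 0
    rw [ρ.eq_one, sub_self]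
  · change evalFn n q h * (1 - ρ q) = evalFn n q h
    by_cases hq : ρ q = 0
    · rw [hq, sub_zero, mul_one]
    · have : evalFn n q h = 0 := hρ hq
      rw [this, zero_mul]

/-- The differential of a function vanishing near `p` vanishes to infinite order at `p`. -/
theorem dFn_mem_ideal_pow_of_eventually_zero [T2Space X] [IsManifold (𝓡 n) ∞ X] {p : X}
    {h : (ofManifold n X).Fn} (hh : ∀ᶠ q in nhds p, evalFn n q h = 0) (k : ℕ) :
    Form.dFn (ofManifold n X) h ∈ ideal n p ^ (k + 1) := by
  obtain ⟨e, he, hhe⟩ := exists_mul_eq_self_of_eventually_zero hh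
  have hmul : Form.ofFn (ofManifold n X) h = Form.ofFn _ h * Form.ofFn (ofManifold n X) e := by
    rw [← map_mul, hhe]
  have hfn : ∀ k : ℕ, Form.ofFn (ofManifold n X) h ∈ ideal n p ^ (k + 1) := by
    intro k
    induction k with
    | zero => rw [zero_add, pow_one]; exact ofFn_mem_ideal hh.self_of_nhds
    | succ k ih =>
      rw [hmul, pow_succ]
      exact Submodule.mul_mem_mul ih (ofFn_mem_ideal he)
  induction k with
  | zero => rw [zero_add, pow_one]; exact dFn_mem_ideal p h
  | succ k ih =>
    rw [← hhe, dFn_mul]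
    refine Submodule.add_mem _ ?_ (maxIdeal_mul_right _ _ (hfn _) _)
    rw [pow_succ]
    exact Submodule.mul_mem_mul ih (ofFn_mem_ideal he)

/-- The `n` functions `x i` vanish at `p`, and every function is, up to its value at `p` and near
`p`, a combination of them with smooth coefficients. -/
structure GeneratesAt (x : Fin n → (ofManifold n X).Fn) (p : X) : Prop where
  vanish : ∀ i, evalFn n p (x i) = 0
  hadamard : ∀ f : (ofManifold n X).Fn, ∃ g : Fin n → (ofManifold n X).Fn, ∀ᶠ q in nhds p,
    evalFn n q f - evalFn n p f = ∑ i, evalFn n q (x i) * evalFn n q (g i)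

theorem exists_generatesAt [T2Space X] [IsManifold (𝓡 n) ∞ X] (p : X) :
    ∃ x : Fin n → (ofManifold n X).Fn, GeneratesAt x p := by
  obtain ⟨x, hx0, hx⟩ := exists_contMDiff_hadamard (n := n) p
  exact ⟨x, hx0, hx⟩

/-- The differentials of the linear combinations of the functions `x i`. -/
def dCoord (x : Fin n → (ofManifold n X).Fn) : (Fin n → ℝ) →ₗ[ℝ] (ofManifold n X).Form :=
  Form.dFn (ofManifold n X) ∘ₗ Fintype.linearCombination ℝ x

/-- The products of `n + 1` differentials of linear combinations of `n` functions vanish. -/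
theorem range_dCoord_pow (x : Fin n → (ofManifold n X).Fn) :
    LinearMap.range (dCoord x) ^ (n + 1) = ⊥ := by
  let φ : ExteriorAlgebra ℝ (Fin n → ℝ) →ₐ[ℝ] (ofManifold n X).Form :=
    ExteriorAlgebra.lift ℝ ⟨dCoord x, fun v => dFn_mul_self _⟩
  have h1 : LinearMap.range (dCoord x) =
      (LinearMap.range (ExteriorAlgebra.ι ℝ (M := Fin n → ℝ))).map φ.toLinearMap := by
    rw [← LinearMap.range_comp]
    congr 1
    exact LinearMap.ext fun v => (ExteriorAlgebra.lift_ι_apply ℝ (dCoord x) _ v).symm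
  have h2 : (⋀[ℝ]^(n + 1) (Fin n → ℝ)) = ⊥ := by
    rw [← ExteriorAlgebra.ιMulti_span_fixedDegree, Submodule.span_eq_bot]
    rintro _ ⟨v, rfl⟩
    refine AlternatingMap.map_linearDependent _ _ fun hv => ?_
    have := hv.fintype_card_le_finrank
    simp at this
  rw [h1, ← Submodule.map_pow]
  exact (congrArg _ h2).trans (Submodule.map_bot _)

/-- The span of the products of functions and `j` differentials of linear combinations of the
functions `x i`. -/
def coordForms (x : Fin n → (ofManifold n X).Fn) (j : ℕ) : Submodule ℝ (ofManifold n X).Form :=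
  LinearMap.range (Form.ofFn (ofManifold n X)).toLinearMap * LinearMap.range (dCoord x) ^ j

theorem coordForms_mul_le (x : Fin n → (ofManifold n X).Fn) (i j : ℕ) :
    coordForms x i * coordForms x j ≤ coordForms x (i + j) := by
  have hc : LinearMap.range (dCoord x) ^ i *
      LinearMap.range (Form.ofFn (ofManifold n X)).toLinearMap ≤
      LinearMap.range (Form.ofFn (ofManifold n X)).toLinearMap *
        LinearMap.range (dCoord x) ^ i := by
    rw [Submodule.mul_le]
    rintro a ha _ ⟨f, rfl⟩
    change a * Form.ofFn _ f ∈ _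
    rw [ofFn_comm]
    exact Submodule.mul_mem_mul ⟨f, rfl⟩ ha
  have hr : LinearMap.range (Form.ofFn (ofManifold n X)).toLinearMap *
      LinearMap.range (Form.ofFn (ofManifold n X)).toLinearMap ≤
      LinearMap.range (Form.ofFn (ofManifold n X)).toLinearMap := by
    rw [Submodule.mul_le]
    rintro _ ⟨f, rfl⟩ _ ⟨g, rfl⟩
    exact ⟨f * g, map_mul (Form.ofFn (ofManifold n X)) f g⟩
  calc coordForms x i * coordForms x j
      = LinearMap.range (Form.ofFn (ofManifold n X)).toLinearMap *
        (LinearMap.range (dCoord x) ^ i *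
          LinearMap.range (Form.ofFn (ofManifold n X)).toLinearMap) *
            LinearMap.range (dCoord x) ^ j := by
        simp only [coordForms, mul_assoc]
    _ ≤ LinearMap.range (Form.ofFn (ofManifold n X)).toLinearMap *
        (LinearMap.range (Form.ofFn (ofManifold n X)).toLinearMap *
          LinearMap.range (dCoord x) ^ i) * LinearMap.range (dCoord x) ^ j :=
        mul_le_mul_left (mul_le_mul_right hc _) _
    _ = LinearMap.range (Form.ofFn (ofManifold n X)).toLinearMap *
        LinearMap.range (Form.ofFn (ofManifold n X)).toLinearMap *
          LinearMap.range (dCoord x) ^ (i + j) := by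
        rw [pow_add]
        simp only [mul_assoc]
    _ ≤ coordForms x (i + j) := mul_le_mul_left hr _

theorem ofFn_mem_coordForms (x : Fin n → (ofManifold n X).Fn) (f : (ofManifold n X).Fn) :
    Form.ofFn _ f ∈ coordForms x 0 := by
  rw [coordForms, pow_zero, mul_one]
  exact ⟨f, rfl⟩

/-- The degrees in `coordForms` add up under products also modulo forms vanishing at `p` to a given
order. -/
theorem mul_mem_coordForms_sup {x : Fin n → (ofManifold n X).Fn} {p : X} {i j k : ℕ}
    {a b : (ofManifold n X).Form} (ha : a ∈ coordForms x i ⊔ ideal n p ^ (k + 1))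
    (hb : b ∈ coordForms x j ⊔ ideal n p ^ (k + 1)) :
    a * b ∈ coordForms x (i + j) ⊔ ideal n p ^ (k + 1) := by
  obtain ⟨c, hc, c', hc', rfl⟩ := Submodule.mem_sup.mp ha
  obtain ⟨e, he, e', he', rfl⟩ := Submodule.mem_sup.mp hb
  rw [add_mul, mul_add, add_assoc]
  exact Submodule.add_mem_sup (coordForms_mul_le x i j (Submodule.mul_mem_mul hc he))
    (Submodule.add_mem _ (maxIdeal_mul_left _ k he' c) (maxIdeal_mul_right _ k hc' _))

/-- The differential of a function is a combination of the differentials of the coordinates modulo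
forms vanishing at `p` to any given order, by iteration of Hadamard's lemma. -/
theorem dFn_mem_coordForms_sup {p : X} {x : Fin n → (ofManifold n X).Fn} [T2Space X]
    [IsManifold (𝓡 n) ∞ X] (hx : GeneratesAt x p) (k : ℕ) (f : (ofManifold n X).Fn) :
    Form.dFn _ f ∈ coordForms x 1 ⊔ ideal n p ^ (k + 1) := by
  induction k generalizing f with
  | zero =>
    rw [zero_add, pow_one]
    exact Submodule.mem_sup_right (dFn_mem_ideal p f)
  | succ k ih =>
    obtain ⟨g, hg⟩ := hx.hadamard f
    let c : ℝ := evalFn n p f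
    let h : (ofManifold n X).Fn := f - c • 1 - ∑ i, x i * g i
    have hh : ∀ᶠ q in nhds p, evalFn n q h = 0 := by
      filter_upwards [hg] with q hq
      simp only [h, map_sub, map_smul, map_one, map_sum, map_mul, smul_eq_mul, mul_one, c, hq,
        sub_self]
    have hf : f = c • 1 + ∑ i, x i * g i + h := by
      simp only [h]
      abel
    rw [hf, map_add, map_add, map_smul, dFn_one, smul_zero, zero_add, map_sum]
    refine Submodule.add_mem _ (Submodule.sum_mem _ fun i _ => ?_)
      (Submodule.mem_sup_right (dFn_mem_ideal_pow_of_eventually_zero hh (k + 1)))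
    rw [dFn_mul, ofFn_comm]
    refine Submodule.add_mem _ (Submodule.mem_sup_left ?_) ?_
    · rw [coordForms, pow_one]
      refine Submodule.mul_mem_mul ⟨g i, rfl⟩ ⟨Pi.single i 1, ?_⟩
      change Form.dFn _ (Fintype.linearCombination ℝ x (Pi.single i 1)) = _
      rw [Fintype.linearCombination_apply_single, one_smul]
    · obtain ⟨a, ha, b, hb, hab⟩ := Submodule.mem_sup.mp (ih (g i))
      rw [← hab, mul_add]
      refine Submodule.add_mem_sup ?_ ?_
      · have := coordForms_mul_le x 0 1
          (Submodule.mul_mem_mul (ofFn_mem_coordForms x (x i)) ha)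
        rwa [zero_add] at this
      · rw [pow_succ']
        exact Submodule.mul_mem_mul (ofFn_mem_ideal (hx.vanish i)) hb

/-- A product of functions and differentials is a form in the coordinate differentials of the same
degree, modulo forms vanishing at `p` to any given order. -/
theorem word_mem_coordForms_sup {p : X} {x : Fin n → (ofManifold n X).Fn} [T2Space X]
    [IsManifold (𝓡 n) ∞ X] (hx : GeneratesAt x p) (k : ℕ) {m : ℤ}
    {w : (ofManifold n X).Form} (hw : Form.Word m w) :
    w = 0 ∨ ∃ j : ℕ, m = j ∧ w ∈ coordForms x j ⊔ ideal n p ^ (k + 1) := by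
  induction hw with
  | one =>
    refine Or.inr ⟨0, rfl, Submodule.mem_sup_left ?_⟩
    rw [← map_one (Form.ofFn (ofManifold n X))]
    exact ofFn_mem_coordForms x 1
  | @fn i m a w ha _ ih =>
    by_cases hi : i = 0
    · rcases ih with rfl | ⟨j, rfl, hj⟩
      · exact Or.inl (mul_zero _)
      · refine Or.inr ⟨j, by rw [hi, zero_add], ?_⟩
        have := mul_mem_coordForms_sup (Submodule.mem_sup_left (ofFn_mem_coordForms x a)) hj
        rwa [zero_add] at this
    · rw [show a = 0 from eq_zero_of_mem_trivialDeg hi ha, map_zero, zero_mul]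
      exact Or.inl rfl
  | @dd i m a w ha _ ih =>
    by_cases hi : i = 0
    · rcases ih with rfl | ⟨j, rfl, hj⟩
      · exact Or.inl (mul_zero _)
      · refine Or.inr ⟨1 + j, by rw [hi]; push_cast; ring, ?_⟩
        exact mul_mem_coordForms_sup (dFn_mem_coordForms_sup hx k a) hj
    · rw [show a = 0 from eq_zero_of_mem_trivialDeg hi ha, map_zero, zero_mul]
      exact Or.inl rfl

/-- On an `n`-dimensional manifold there are no nonzero forms of degree `n + 1`. -/
theorem eq_zero_of_mem_deg_succ [T2Space X] [IsManifold (𝓡 n) ∞ X] {a : (T1X n X).Fn}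
    (ha : a ∈ (T1X n X).deg (n + 1)) : a = 0 := by
  have hword : ∀ w : (ofManifold n X).Form, Form.Word ((n : ℤ) + 1) w → w = 0 := by
    intro w hw
    refine Form.eq_zero_of_flat (ofManifold n X) w ?_
    rintro _ ⟨p, rfl⟩ k
    obtain ⟨x, hx⟩ := exists_generatesAt (n := n) p
    rcases word_mem_coordForms_sup hx k hw with rfl | ⟨j, hj, hwj⟩
    · exact Submodule.zero_mem _
    · obtain rfl : n + 1 = j := by exact_mod_cast hj
      rwa [coordForms, range_dCoord_pow, Submodule.mul_bot, bot_sup_eq] at hwj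
  have h : Form.deg (ofManifold n X) (n + 1) ≤ ⊥ := by
    rw [Form.deg, Submodule.span_le]
    intro w hw
    exact hword w hw
  exact (Submodule.mem_bot ℝ).mp (h ha)

end ManifoldForm

/-! ### The variation of the integrand -/

namespace GradedSpace

variable {M : GradedSpace.{u}} {k l : ℤ}

theorem contract_eq_of_toFun_eq (hk : k = l) {V : VectorField M k} {W : VectorField M l}
    (h : V.toFun = W.toFun) (x : M.T1.Fn) : contract V x = contract W x := by
  subst hk
  cases V; cases W; cases h; rfl

theorem contract_of_toFun_eq_zero {V : VectorField M k} (h : V.toFun = 0) (x : M.T1.Fn) :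
    contract V x = 0 := by
  have h1 := (contract_isDerivation V).ext_forms IsDerivation.zero
    (fun {i a} _ => contract_fn V a)
    (fun {i a} _ => by
      change contract V (M.dfn a) = 0
      rw [contract_dfn, h, LinearMap.zero_apply, map_zero])
  exact LinearMap.congr_fun h1 x

theorem bracket_apply (V : VectorField M k) (W : VectorField M l) (a : M.Fn) :
    (bracket V W).toFun a = V.toFun (W.toFun a) - sgn (k * l) • W.toFun (V.toFun a) := rfl

/-- For vector fields of degrees `1` and `-1`, which are both odd, `[V, W] = V W + W V`. -/
theorem bracket_one_neg_one (V : VectorField M 1) (W : VectorField M (-1)) (a : M.Fn) :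
    (bracket V W).toFun a = V.toFun (W.toFun a) + W.toFun (V.toFun a) := by
  rw [bracket_apply, one_mul, sgn_neg, sgn_one, neg_smul, one_smul, sub_neg_eq_add]

/-- A bracket with a homological vector field commutes with it, hence so do its Lie derivative and
the contraction with the homological vector field. -/
theorem lie_bracket_contract {D : VectorField M 1} (hD : ∀ a, D.toFun (D.toFun a) = 0)
    (W : VectorField M (-1)) (x : M.T1.Fn) :
    lie (bracket D W) (contract D x) = contract D (lie (bracket D W) x) := by
  have h : (bracket (bracket D W) D).toFun = 0 := by
    refine LinearMap.ext fun a => ?_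
    rw [bracket_apply, bracket_one_neg_one, bracket_one_neg_one, hD, map_add, hD, map_zero,
      add_zero, zero_add, show sgn ((1 + -1) * 1) = 1 by simp, one_smul, sub_self]
    rfl
  rw [lie_contract, contract_of_toFun_eq_zero h, add_zero,
    show sgn ((1 + -1) * (1 - 1)) = 1 by simp, one_smul]

/-- For a homological vector field `D` and a form `x`, the form degree zero component of
`i_D i_D d x` is twice the one of `D i_D x`. -/
theorem scalar_contract_contract_d {D : VectorField M 1} (hD : ∀ a, D.toFun (D.toFun a) = 0)
    (x : M.T1.Fn) :
    M.scalar (contract D (contract D (M.d x))) =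
      (2 : ℝ) • D.toFun (M.scalar (contract D x)) := by
  have h0 : (bracket D D).toFun = 0 := by
    refine LinearMap.ext fun a => ?_
    rw [bracket_apply, hD, smul_zero, sub_zero]
    rfl
  have h1 := lie_contract D D x
  rw [contract_of_toFun_eq_zero h0, add_zero, show sgn (1 * (1 - 1)) = 1 by simp, one_smul] at h1
  have h2 := congrArg M.scalar h1
  rw [scalar_lie, lie, contract_add, contract_smul, map_add, map_smul, scalar_contract_d, sgn_one,
    neg_smul, one_smul] at h2
  rw [two_smul]
  exact (add_eq_of_eq_add_neg h2).symm

end GradedSpace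

namespace PresymplecticGaugePDE

variable {n : ℕ} {X : Type u} [TopologicalSpace X] [ChartedSpace (EuclideanSpace ℝ (Fin n)) X]

theorem dX_dX (a : (T1X n X).Fn) : (dX n X).toFun ((dX n X).toFun a) = 0 :=
  d_d (M := ofManifold n X) a

variable {P : PresymplecticGaugePDE.{u, v, w} n X}

theorem lie_symp {χ : P.E.T1.Fn} (hω : P.E.d χ = P.symp) (Y : VectorField P.E (-1)) :
    lie Y P.symp = -P.E.d (lie Y χ) := by
  rw [← hω, lie_d, sgn_neg, sgn_one, neg_smul, one_smul]

/-- `[L_Y, i_Q] = i_{[Q, Y]}`. -/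
theorem lie_contract_Q (Y : VectorField P.E (-1)) (x : P.E.T1.Fn) :
    lie Y (contract P.Q x) = contract P.Q (lie Y x) + contract (bracket P.Q Y) x := by
  rw [lie_contract, show sgn (-1 * (1 - 1)) = 1 by simp, one_smul]
  congr 1
  refine contract_eq_of_toFun_eq (by norm_num) (LinearMap.ext fun a => ?_) x
  rw [bracket_one_neg_one, bracket_apply, mul_one, sgn_neg, sgn_one, neg_smul, one_smul,
    sub_neg_eq_add, add_comm]

theorem contract_bracket_contract_Q (Y : VectorField P.E (-1)) (x : P.E.T1.Fn) :
    contract (bracket P.Q Y) (contract P.Q x) = contract P.Q (contract (bracket P.Q Y) x) := by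
  rw [contract_contract, show sgn ((1 + -1 - 1) * (1 - 1)) = 1 by simp, one_smul]

namespace Sec

variable (σ : P.Sec)

theorem evalDX_add (a b : P.E.T1.Fn) : σ.evalDX (a + b) = σ.evalDX a + σ.evalDX b := by
  rw [evalDX, pullForm_add, contract_add, evalDX, evalDX]

theorem evalDX_neg (a : P.E.T1.Fn) : σ.evalDX (-a) = -σ.evalDX a := by
  rw [← neg_one_smul ℝ a, evalDX, pullForm_smul, contract_smul, neg_one_smul, evalDX]

theorem scalar_evalDX_d (a : P.E.T1.Fn) :
    (T1X n X).scalar (σ.evalDX (P.E.d a)) = (dX n X).toFun (σ.map.pull (P.E.scalar a)) := by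
  rw [evalDX, pullForm_d, scalar_contract_d, scalar_pullForm]

/-- The variation of the pullback of forms is `σ^* L_{[Q, Y]} - L_{[d_X, y]} σ^*`. -/
theorem formVariation_gaugeVariation (Y : VectorField P.E (-1)) (y : VectorField (T1X n X) (-1))
    (x : P.E.T1.Fn) :
    (formVariation (σ.gaugeVariation Y y)).toFun x =
      pullForm σ.map (lie (bracket P.Q Y) x) - lie (bracket (dX n X) y) (pullForm σ.map x) := by
  have e : (1 + -1 : ℤ) = 0 := by norm_num
  have s0 : sgn (1 + -1) = 1 := by rw [e, sgn_zero]
  have h1 := ((lie_isDerivation (bracket P.Q Y)).pull_comp (T1.map σ.map)).of_eq e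
  have h2 := ((lie_isDerivation (bracket (dX n X) y)).comp_pull (T1.map σ.map)).of_eq e
  have h := (formVariation (σ.gaugeVariation Y y)).isDerivation.ext_forms
    (h1.sub h2)
    (fun {i a} _ => by
      rw [formVariation_fn]
      change _ = pullForm σ.map (lie (bracket P.Q Y) (P.E.fn a)) -
        lie (bracket (dX n X) y) (pullForm σ.map (P.E.fn a))
      rw [lie_fn, pullForm_fn, pullForm_fn, lie_fn, ← map_sub]
      rfl)
    (fun {i a} _ => by
      rw [formVariation_dfn]
      change _ = pullForm σ.map (lie (bracket P.Q Y) (P.E.dfn a)) -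
        lie (bracket (dX n X) y) (pullForm σ.map (P.E.dfn a))
      rw [lie_dfn, pullForm_smul, pullForm_dfn, pullForm_dfn, lie_dfn, s0, one_smul, one_smul,
        ← map_sub]
      rfl)
  exact LinearMap.congr_fun h x

/-- The variation of the integrand in terms of the Lie derivative of the presymplectic potential. -/
theorem integrandVariation_gaugeVariation (χ : P.E.T1.Fn) (Y : VectorField P.E (-1))
    (y : VectorField (T1X n X) (-1)) :
    σ.integrandVariation χ (σ.gaugeVariation Y y) =
      (T1X n X).scalar (σ.evalDX (lie (bracket P.Q Y) χ)) +
        σ.map.pull ((bracket P.Q Y).toFun P.L) -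
        (bracket (dX n X) y).toFun (σ.integrand χ) := by
  rw [integrandVariation, formVariation_gaugeVariation, sub_eq_add_neg, contract_add,
    contract_neg, ← lie_bracket_contract dX_dX, map_add, map_neg, scalar_lie, integrand, map_add]
  change _ + (σ.map.pull ((bracket P.Q Y).toFun P.L) -
    (bracket (dX n X) y).toFun (σ.map.pull P.L)) = _
  rw [evalDX, evalDX]
  abel

/-- The three terms combine to `σ^*(i_{[Q, Y]} ω)(d_X) + σ^*([Q, Y] L)` up to total derivatives:
the terms quadratic in `d_X` are exact, and the terms without `d_X` cancel because
`[[L_Y, i_Q], i_Q] = [i_{[Q, Y]}, i_Q] = 0`. -/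
theorem threeTerm_eq {χ : P.E.T1.Fn} (hω : P.E.d χ = P.symp) (Y : VectorField P.E (-1)) :
    σ.threeTerm Y =
      (T1X n X).scalar (σ.evalDX (contract (bracket P.Q Y) P.symp)) +
        σ.map.pull ((bracket P.Q Y).toFun P.L) -
        (dX n X).toFun (σ.map.pull (Y.toFun P.L)) -
        (dX n X).toFun ((T1X n X).scalar (σ.evalDX (lie Y χ))) := by
  have hL : lie Y (P.E.d (P.E.fn P.L)) = -P.E.d (P.E.fn (Y.toFun P.L)) := by
    rw [lie_d, lie_fn, sgn_neg, sgn_one, neg_smul, one_smul]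
  have hQL : contract P.Q (P.E.d (P.E.fn (Y.toFun P.L))) = P.E.fn (P.Q.toFun (Y.toFun P.L)) := by
    rw [d_fn, contract_dfn]
  have h2 : (T1X n X).scalar (contract (dX n X) (σ.evalDX (lie Y P.symp))) =
      -((2 : ℝ) • (dX n X).toFun ((T1X n X).scalar (σ.evalDX (lie Y χ)))) := by
    rw [lie_symp hω, evalDX_neg, contract_neg, map_neg, evalDX, pullForm_d,
      scalar_contract_contract_d dX_dX, ← evalDX]
  rw [threeTerm, contractE2, contractE]
  simp only [lie_add, lie_smul, lie_fn, lie_contract_Q, contract_add, contract_bracket_contract_Q,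
    hL, contract_neg, hQL, evalDX_add, evalDX_neg, pullForm_add, pullForm_smul, map_add, map_sub,
    map_smul, map_neg, scalar_evalDX_d, h2, scalar_pullForm, scalar_fn, bracket_one_neg_one]
  module

/-- The first variation of the integrand, provided that the integrand is closed. -/
theorem integrandVariation_eq {χ : P.E.T1.Fn} (hω : P.E.d χ = P.symp) (Y : VectorField P.E (-1))
    (y : VectorField (T1X n X) (-1)) (h0 : (dX n X).toFun (σ.integrand χ) = 0) :
    σ.integrandVariation χ (σ.gaugeVariation Y y) =
      σ.threeTerm Y + (dX n X).toFun (σ.current χ Y y) := by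
  have h1 : lie (bracket P.Q Y) χ =
      contract (bracket P.Q Y) P.symp + P.E.d (contract (bracket P.Q Y) χ) := by
    rw [lie, hω, show sgn (1 + -1) = 1 by simp, one_smul]
  rw [integrandVariation_gaugeVariation, σ.threeTerm_eq hω, h1, evalDX_add, map_add,
    scalar_evalDX_d, current, map_sub, map_add, map_add, map_add, bracket_one_neg_one (dX n X), h0,
    map_zero]
  abel

end Sec

end PresymplecticGaugePDE

/-! ### One-forms and their contractions -/

namespace GradedSpace

variable {M : GradedSpace.{u}} {N : GradedSpace.{v}} {k l : ℤ}

/-- One-forms with the coefficients on the right: no signs appear when they are contracted. -/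
theorem formsOfDegree_one_induction {C : M.T1.Fn → Prop}
    (hadd : ∀ x y, C x → C y → C (x + y))
    (hmul : ∀ (i j : ℤ) (h g : M.Fn), h ∈ M.deg i → g ∈ M.deg j → C (M.dfn h * M.fn g))
    {β : M.T1.Fn} (hβ : β ∈ M.formsOfDegree 1) : C β := by
  have h00 : C 0 := by
    have := hmul 0 0 0 0 (Submodule.zero_mem _) (Submodule.zero_mem _)
    rwa [map_zero, zero_mul] at this
  rw [formsOfDegree, Submodule.pow_one] at hβ
  induction hβ using Submodule.mul_induction_on' with
  | mem_mul_mem a ha b hb =>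
    obtain ⟨f, rfl⟩ := ha
    obtain ⟨h, rfl⟩ := hb
    change C (M.fn f * M.dfn h)
    induction f using M.hom_induction with
    | h0 => rwa [map_zero, zero_mul]
    | hadd a b ha hb => rw [map_add, add_mul]; exact hadd _ _ ha hb
    | hom j f hf =>
      induction h using M.hom_induction with
      | h0 => rwa [map_zero, mul_zero]
      | hadd a b ha hb => rw [map_add, mul_add]; exact hadd _ _ ha hb
      | hom i h hh =>
        rw [M.T1.gradedComm (fn_mem hf) (dfn_mem hh), ← mul_smul_comm, ← map_smul]
        exact hmul i j h _ hh (Submodule.smul_mem _ _ hf)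
  | add x _ y _ hx hy => exact hadd x y hx hy

theorem dfn_mul_fn_mem (h g : M.Fn) : M.dfn h * M.fn g ∈ M.formsOfDegree 1 := by
  rw [formsOfDegree, Submodule.pow_one]
  induction g using M.hom_induction with
  | h0 => simp
  | hadd a b ha hb => rw [map_add, mul_add]; exact Submodule.add_mem _ ha hb
  | hom j g hg =>
    induction h using M.hom_induction with
    | h0 => simp
    | hadd a b ha hb => rw [map_add, add_mul]; exact Submodule.add_mem _ ha hb
    | hom i h hh =>
      rw [M.T1.gradedComm (dfn_mem hh) (fn_mem hg)]
      exact Submodule.smul_mem _ _ (Submodule.mul_mem_mul ⟨g, rfl⟩ ⟨h, rfl⟩)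

theorem contract_dfn_mul_fn (V : VectorField M k) {i : ℤ} {h : M.Fn} (hh : h ∈ M.deg i)
    (g : M.Fn) : contract V (M.dfn h * M.fn g) = M.fn (V.toFun h * g) := by
  have := (contract_isDerivation V).leibniz (dfn_mem hh) (M.fn g)
  rw [contraction_apply, contraction_apply, contraction_apply, contract_dfn, contract_fn, mul_zero,
    smul_zero, add_zero] at this
  rw [map_mul]
  exact this

theorem contract_mul_of_degree_one (V : VectorField M 1) (x y : M.T1.Fn) :
    contract V (x * y) = contract V x * y + x * contract V y :=
  ((contract_isDerivation V).of_eq (sub_self 1)).leibniz_zero x y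

theorem pullForm_mem_formsOfDegree_one (φ : Hom M N) {β : N.T1.Fn} (hβ : β ∈ N.formsOfDegree 1) :
    pullForm φ β ∈ M.formsOfDegree 1 := by
  refine formsOfDegree_one_induction (C := fun β => pullForm φ β ∈ M.formsOfDegree 1) ?_ ?_ hβ
  · intro x y hx hy
    rw [pullForm_add]
    exact Submodule.add_mem _ hx hy
  · intro i j h g _ _
    rw [pullForm_mul, pullForm_dfn, pullForm_fn]
    exact dfn_mul_fn_mem _ _

theorem lie_mem_formsOfDegree_one (V : VectorField M k) {β : M.T1.Fn}
    (hβ : β ∈ M.formsOfDegree 1) : lie V β ∈ M.formsOfDegree 1 := by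
  refine formsOfDegree_one_induction (C := fun β => lie V β ∈ M.formsOfDegree 1) ?_ ?_ hβ
  · intro x y hx hy
    rw [lie_add]
    exact Submodule.add_mem _ hx hy
  · intro i j h g hh _
    have := (lie_isDerivation V).leibniz (dfn_mem hh) (M.fn g)
    rw [lieLin_apply, lieLin_apply, lieLin_apply, lie_dfn, lie_fn] at this
    rw [this]
    refine Submodule.add_mem _ ?_ (Submodule.smul_mem _ _ (dfn_mul_fn_mem _ _))
    change (sgn k • M.dfn (V.toFun h)) * M.fn g ∈ _
    rw [smul_mul_assoc]
    exact Submodule.smul_mem _ _ (dfn_mul_fn_mem _ _)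

theorem fn_scalar_contract (V : VectorField M k) {β : M.T1.Fn} (hβ : β ∈ M.formsOfDegree 1) :
    M.fn (M.scalar (contract V β)) = contract V β := by
  refine formsOfDegree_one_induction
    (C := fun β => M.fn (M.scalar (contract V β)) = contract V β) ?_ ?_ hβ
  · intro x y hx hy
    rw [contract_add, map_add, map_add, hx, hy]
  · intro i j h g hh _
    rw [contract_dfn_mul_fn V hh, scalar_fn]

theorem scalar_formsOfDegree_one {β : M.T1.Fn} (hβ : β ∈ M.formsOfDegree 1) : M.scalar β = 0 := by
  refine formsOfDegree_one_induction (C := fun β => M.scalar β = 0) ?_ ?_ hβ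
  · intro x y hx hy
    rw [map_add, hx, hy, add_zero]
  · intro i j h g _ _
    rw [map_mul, scalar_dfn, zero_mul]

theorem lie_pullForm {φ : Hom M N} {V : VectorField M k} {v : VectorField N k}
    (h : ProjectsTo φ V v) (x : N.T1.Fn) : lie V (pullForm φ x) = pullForm φ (lie v x) := by
  have h1 := ((lie_isDerivation V).comp_pull (T1.map φ)).ext_forms
    ((lie_isDerivation v).pull_comp (T1.map φ))
    (fun {i a} _ => by
      change lie V (pullForm φ (N.fn a)) = pullForm φ (lie v (N.fn a))
      rw [pullForm_fn, lie_fn, lie_fn, pullForm_fn, h])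
    (fun {i a} _ => by
      change lie V (pullForm φ (N.dfn a)) = pullForm φ (lie v (N.dfn a))
      rw [pullForm_dfn, lie_dfn, lie_dfn, pullForm_smul, pullForm_dfn, h])
  exact LinearMap.congr_fun h1 x

theorem projectsTo_bracket {φ : Hom M N} {V : VectorField M k} {v : VectorField N k}
    {W : VectorField M l} {w : VectorField N l} (hV : ProjectsTo φ V v) (hW : ProjectsTo φ W w) :
    ProjectsTo φ (bracket V W) (bracket v w) := by
  intro f
  rw [bracket_apply, bracket_apply, hV, hW, hV, hW, map_sub, map_smul]

/-- The contraction of a one-form on the base with the projection of a vector field extends to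
arbitrary linear maps on the total space, linearly over the functions there. -/
theorem exists_linear_contraction (φ : Hom M N) {β : N.T1.Fn} (hβ : β ∈ N.formsOfDegree 1) :
    ∃ C : (M.Fn →ₗ[ℝ] M.Fn) →ₗ[M.Fn] M.Fn, ∀ (k : ℤ) (v : VectorField N k)
      (F : M.Fn →ₗ[ℝ] M.Fn), (∀ f, F (φ.pull f) = φ.pull (v.toFun f)) →
        C F = φ.pull (N.scalar (contract v β)) := by
  refine formsOfDegree_one_induction (C := fun β => ∃ C : (M.Fn →ₗ[ℝ] M.Fn) →ₗ[M.Fn] M.Fn,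
    ∀ (k : ℤ) (v : VectorField N k) (F : M.Fn →ₗ[ℝ] M.Fn),
      (∀ f, F (φ.pull f) = φ.pull (v.toFun f)) → C F = φ.pull (N.scalar (contract v β))) ?_ ?_ hβ
  · rintro x y ⟨C, hC⟩ ⟨C', hC'⟩
    refine ⟨C + C', fun k v F hF => ?_⟩
    rw [LinearMap.add_apply, hC k v F hF, hC' k v F hF, contract_add, map_add, map_add]
  · intro i j h g hh _
    refine ⟨{ toFun := fun F => F (φ.pull h) * φ.pull g
              map_add' := fun F G => by rw [LinearMap.add_apply, add_mul]
              map_smul' := fun f F => by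
                rw [LinearMap.smul_apply, smul_eq_mul, mul_assoc]; rfl }, fun k v F hF => ?_⟩
    change F (φ.pull h) * φ.pull g = _
    rw [contract_dfn_mul_fn v hh, scalar_fn, map_mul, hF]

end GradedSpace

/-! ### The background ideal -/

namespace PresymplecticGaugePDE

variable {n : ℕ} {X : Type u} [TopologicalSpace X] [ChartedSpace (EuclideanSpace ℝ (Fin n)) X]
  {P : PresymplecticGaugePDE.{u, v, w} n X}

/-- A one-form on the background annihilated by `K_B` is annihilated by the projection of every
projectable element of the distribution on `E`. -/
theorem contract_eq_zero_of_mem_distribution {β : P.B.T1.Fn} (hβ : β ∈ P.B.formsOfDegree 1)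
    (hK : ∀ (k : ℤ) (V : VectorField P.B k), V.toFun ∈ P.K → contract V β = 0)
    {k : ℤ} {V : VectorField P.E k} {v : VectorField P.B k} (hV : ProjectsTo P.projB V v)
    (hmem : V.toFun ∈ P.distribution) : contract v β = 0 := by
  obtain ⟨C, hC⟩ := exists_linear_contraction P.projB hβ
  have h : ∀ F ∈ P.distribution, C F = 0 := by
    intro F hF
    induction hF using Submodule.span_induction with
    | mem F hF =>
      obtain ⟨k, W, w, rfl, hW, hw, -⟩ := hF
      rw [hC k w W.toFun hW, hK k w hw, map_zero, map_zero]
    | zero => exact map_zero C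
    | add F G _ _ hF hG => rw [map_add, hF, hG, add_zero]
    | smul f F _ hF => rw [map_smul, hF, smul_zero]
  have h1 := h _ hmem
  rw [hC k v V.toFun hV] at h1
  rw [← fn_scalar_contract v hβ,
    P.projB_injective (h1.trans (map_zero P.projB.pull).symm), map_zero]

/-- The Lie derivative along the projection of a symmetry of the distribution preserves the
one-forms annihilated by `K_B`. -/
theorem contract_lie_eq_zero {Y : VectorField P.E (-1)} {yB : VectorField P.B (-1)}
    (hY : ProjectsTo P.projB Y yB) (hpres : P.PreservesDistribution Y)
    {β : P.B.T1.Fn} (hβ : β ∈ P.B.formsOfDegree 1)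
    (hK : ∀ (k : ℤ) (V : VectorField P.B k), V.toFun ∈ P.K → contract V β = 0)
    {k : ℤ} (v : VectorField P.B k) (hv : v.toFun ∈ P.K) : contract v (lie yB β) = 0 := by
  obtain ⟨V, hV, hVω⟩ := P.exists_lift v hv
  have hmem : V.toFun ∈ P.distribution := Submodule.subset_span ⟨k, V, v, rfl, hV, hv, hVω⟩
  have h0 := contract_eq_zero_of_mem_distribution hβ hK (projectsTo_bracket hY hV) (hpres V hmem)
  have h1 := lie_contract yB v β
  rw [h0, hK k v hv, lie_zero, add_zero] at h1
  rw [← one_smul ℝ (contract v (lie yB β)), ← sgn_mul_self (-1 * (k - 1)), mul_smul, ← h1,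
    smul_zero]

/-- A projectable symmetry of the distribution preserves the ideal `I_B`. -/
theorem lie_mem_idealB {Y : VectorField P.E (-1)} {yB : VectorField P.B (-1)}
    (hY : ProjectsTo P.projB Y yB) (hpres : P.PreservesDistribution Y) {x : P.E.T1.Fn}
    (hx : x ∈ P.idealB) : lie Y x ∈ P.idealB := by
  induction hx using Submodule.span_induction with
  | mem x hx =>
    obtain ⟨β, hβ, hK, rfl⟩ := hx
    rw [lie_pullForm hY]
    exact Ideal.subset_span ⟨lie yB β, lie_mem_formsOfDegree_one yB hβ,
      fun k v hv => contract_lie_eq_zero hY hpres hβ hK v hv, rfl⟩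
  | zero => rw [lie_zero]; exact Ideal.zero_mem _
  | add x y _ _ hx hy => rw [lie_add]; exact Ideal.add_mem _ hx hy
  | smul c x hx ih =>
    have := (lie_isDerivation Y).leibniz_parity c x
    rw [lieLin_apply, lieLin_apply] at this
    rw [smul_eq_mul, this]
    exact Ideal.add_mem _ (Ideal.mul_mem_left _ _ hx) (Ideal.mul_mem_left _ _ ih)

namespace Sec

variable (σ : P.Sec)

theorem evalDX_mul (x y : P.E.T1.Fn) :
    σ.evalDX (x * y) = σ.evalDX x * pullForm σ.map y + pullForm σ.map x * σ.evalDX y := by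
  rw [evalDX, pullForm_mul, contract_mul_of_degree_one, evalDX, evalDX]

/-- `i_{E_σ}` is a derivation along `σ`. -/
theorem contractE_mul (x y : P.E.T1.Fn) :
    σ.contractE (x * y) = σ.contractE x * pullForm σ.map y + pullForm σ.map x * σ.contractE y := by
  rw [contractE, evalDX_mul, contract_mul_of_degree_one, pullForm_add, pullForm_mul, pullForm_mul,
    contractE, contractE, sub_mul, mul_sub]
  abel

theorem contractE_add (x y : P.E.T1.Fn) :
    σ.contractE (x + y) = σ.contractE x + σ.contractE y := by
  rw [contractE, evalDX_add, contract_add, pullForm_add, contractE, contractE]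
  abel

theorem contractE2_add (x y : P.E.T1.Fn) :
    σ.contractE2 (x + y) = σ.contractE2 x + σ.contractE2 y := by
  simp only [contractE2, evalDX_add, contract_add, pullForm_add]
  module

/-- `i_{E_σ}²` is a second order operator with symbol given by `i_{E_σ}`. -/
theorem contractE2_mul (x y : P.E.T1.Fn) :
    σ.contractE2 (x * y) = σ.contractE2 x * pullForm σ.map y + pullForm σ.map x * σ.contractE2 y +
      (4 : ℝ) • (σ.contractE x * σ.contractE y) := by
  have hD : ∀ a : P.E.T1.Fn, contract (dX n X) (pullForm σ.map a) = σ.evalDX a := fun _ => rfl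
  simp only [contractE2, contractE, evalDX_mul, contract_mul_of_degree_one, contract_add,
    pullForm_add, pullForm_mul, evalDX_add, hD]
  simp only [sub_mul, mul_sub, add_mul, mul_add, smul_mul_assoc, mul_smul_comm, smul_sub, smul_add,
    smul_smul]
  module

/-- On pullbacks from the background `E_σ` is the failure of the projected section to solve the
background equations, which is an element `κ` of the distribution. -/
theorem contractE_pullForm {κ : VectorField P.B 1}
    (hκ : ∀ f : P.B.Fn, (dX n X).toFun (σ.map.pull (P.projB.pull f)) =
      σ.map.pull (P.projB.pull (P.γ.toFun f)) + σ.map.pull (P.projB.pull (κ.toFun f)))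
    {β : P.B.T1.Fn} (hβ : β ∈ P.B.formsOfDegree 1) :
    σ.contractE (pullForm P.projB β) = pullForm σ.map (pullForm P.projB (contract κ β)) := by
  refine formsOfDegree_one_induction (C := fun β => σ.contractE (pullForm P.projB β) =
    pullForm σ.map (pullForm P.projB (contract κ β))) ?_ ?_ hβ
  · intro x y hx hy
    rw [pullForm_add, contractE_add, hx, hy, contract_add, pullForm_add, pullForm_add]
  · intro i j h g hh _
    have h1 := P.projB.map_deg hh
    rw [contractE, evalDX, pullForm_mul, pullForm_mul, pullForm_dfn, pullForm_dfn, pullForm_fn,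
      pullForm_fn, contract_dfn_mul_fn _ (σ.map.map_deg h1), contract_dfn_mul_fn _ h1,
      contract_dfn_mul_fn _ hh, pullForm_fn, pullForm_fn, pullForm_fn, hκ, P.Q_proj, ← map_sub,
      map_mul, map_mul, map_mul, add_mul, add_sub_cancel_left]

theorem contractE2_formsOfDegree_one {α : P.E.T1.Fn} (hα : α ∈ P.E.formsOfDegree 1) :
    σ.contractE2 α = 0 := by
  have h1 : contract (dX n X) (σ.evalDX α) = 0 := by
    rw [evalDX, ← fn_scalar_contract (dX n X) (pullForm_mem_formsOfDegree_one σ.map hα),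
      contract_fn]
  have h2 : σ.evalDX (contract P.Q α) = 0 := by
    rw [evalDX, ← fn_scalar_contract P.Q hα, pullForm_fn, contract_fn]
  have h3 : contract P.Q (contract P.Q α) = 0 := by
    rw [← fn_scalar_contract P.Q hα, contract_fn]
  rw [contractE2, h1, h2, h3, pullForm_zero, smul_zero, sub_zero, add_zero, smul_zero]

/-- For a section projecting to a solution of the background equations, `i_{E_σ}` and `i_{E_σ}²`
vanish on the ideal `I_B`, in form degree zero. -/
theorem scalar_contractE_idealB (hσ : σ.SolvesBackground) {x : P.E.T1.Fn} (hx : x ∈ P.idealB) :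
    (T1X n X).scalar (σ.contractE x) = 0 ∧ (T1X n X).scalar (σ.contractE2 x) = 0 := by
  obtain ⟨κ, hκK, hκ⟩ := hσ
  suffices h : (T1X n X).scalar (pullForm σ.map x) = 0 ∧ (T1X n X).scalar (σ.contractE x) = 0 ∧
      (T1X n X).scalar (σ.contractE2 x) = 0 from h.2
  induction hx using Submodule.span_induction with
  | mem x hx =>
    obtain ⟨β, hβ, hK, rfl⟩ := hx
    have h1 := pullForm_mem_formsOfDegree_one P.projB hβ
    refine ⟨?_, ?_, ?_⟩
    · rw [scalar_pullForm, scalar_formsOfDegree_one h1, map_zero]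
    · rw [σ.contractE_pullForm hκ hβ, hK 1 κ hκK, pullForm_zero, pullForm_zero, map_zero]
    · rw [σ.contractE2_formsOfDegree_one h1, map_zero]
  | zero =>
    have h1 : (0 : P.E.T1.Fn) ∈ P.E.formsOfDegree 1 := Submodule.zero_mem _
    refine ⟨?_, ?_, ?_⟩
    · rw [pullForm_zero, map_zero]
    · rw [contractE, evalDX, contract_zero, pullForm_zero, contract_zero, sub_zero, map_zero]
    · rw [σ.contractE2_formsOfDegree_one h1, map_zero]
  | add x y _ _ hx hy =>
    rw [pullForm_add, contractE_add, contractE2_add, map_add, map_add, map_add, hx.1, hx.2.1,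
      hx.2.2, hy.1, hy.2.1, hy.2.2, add_zero]
    exact ⟨rfl, rfl, rfl⟩
  | smul c x _ hx =>
    rw [smul_eq_mul, pullForm_mul, contractE_mul, contractE2_mul]
    simp only [map_add, map_mul, map_smul, hx.1, hx.2.1, hx.2.2, mul_zero, add_zero, smul_zero,
      and_self]

/-- The three terms vanish for sections over solutions of the background equations. -/
theorem threeTerm_eq_zero {Y : VectorField P.E (-1)} {yB : VectorField P.B (-1)}
    (hY : ProjectsTo P.projB Y yB) (hpres : P.PreservesDistribution Y)
    (hω : lie Y P.symp ∈ P.idealB) (hσ : σ.SolvesBackground) : σ.threeTerm Y = 0 := by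
  rw [threeTerm, P.master, lie_zero, pullForm_zero, zero_add, map_add, map_smul,
    (σ.scalar_contractE_idealB hσ (lie_mem_idealB hY hpres P.hamiltonian)).1,
    (σ.scalar_contractE_idealB hσ hω).2, smul_zero, add_zero]

end Sec

end PresymplecticGaugePDE

/-! ### Variation of the action -/

namespace PresymplecticGaugePDE.Sec

variable {n : ℕ} {X : Type u} [TopologicalSpace X] [ChartedSpace (EuclideanSpace ℝ (Fin n)) X]
  {P : PresymplecticGaugePDE.{u, v, w} n X} (σ : P.Sec)

theorem integrand_mem {χ : P.E.T1.Fn} (hχ : χ ∈ P.E.forms 1 ((n : ℤ) - 1)) :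
    σ.integrand χ ∈ (T1X n X).deg n := by
  refine Submodule.add_mem _ ?_ (σ.map.map_deg P.L_deg)
  have h := Form.scalar_deg _ ((contraction (dX n X)).map_deg ((T1.map σ.map).map_deg hχ.2))
  have e : ((1 : ℕ) + ((n : ℤ) - 1) + (1 - 1)) = n := by push_cast; ring
  rwa [e] at h

/-- The integrand is a form of top degree on `X`, hence closed. -/
theorem dX_integrand [T2Space X] [IsManifold (𝓡 n) ∞ X] {χ : P.E.T1.Fn}
    (hχ : χ ∈ P.E.forms 1 ((n : ℤ) - 1)) : (dX n X).toFun (σ.integrand χ) = 0 :=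
  ManifoldForm.eq_zero_of_mem_deg_succ ((dX n X).map_deg (σ.integrand_mem hχ))

end PresymplecticGaugePDE.Sec

end
end GradedGeometry

theorem mainTheorem3 {n : ℕ} {X : Type u} [TopologicalSpace X] [T2Space X] [SigmaCompactSpace X]
    [ChartedSpace (EuclideanSpace ℝ (Fin n)) X] [IsManifold (𝓡 n) ∞ X]
    (P : GradedGeometry.PresymplecticGaugePDE.{u, v, w} n X)
    (χ : P.E.T1.Fn) (hχ : χ ∈ P.E.forms 1 ((n : ℤ) - 1)) (hω : P.E.d χ = P.symp)
    (Y : GradedGeometry.VectorField P.E (-1))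
    (y : GradedGeometry.VectorField (GradedGeometry.T1X n X) (-1))
    (hY : GradedGeometry.ProjectsTo P.projX Y y) :
    (∀ σ : P.Sec,
      σ.integrandVariation χ (σ.gaugeVariation Y y) =
        σ.threeTerm Y + (GradedGeometry.dX n X).toFun (σ.current χ Y y)) ∧
    (∀ yB : GradedGeometry.VectorField P.B (-1), GradedGeometry.ProjectsTo P.projB Y yB →
      P.PreservesDistribution Y → GradedGeometry.GradedSpace.lie Y P.symp ∈ P.idealB →
      ∀ σ : P.Sec, σ.SolvesBackground →
        σ.integrandVariation χ (σ.gaugeVariation Y y) =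
          (GradedGeometry.dX n X).toFun (σ.current χ Y y)) := by
  refine ⟨fun σ => σ.integrandVariation_eq hω Y y (σ.dX_integrand hχ),
    fun yB hYB hpres hLω σ hσ => ?_⟩
  rw [σ.integrandVariation_eq hω Y y (σ.dX_integrand hχ),
    σ.threeTerm_eq_zero hYB hpres hLω hσ, zero_add]
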